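/- Let $\mathbb{G}$ be a finite quantum group, i.e. $C(\mathbb{G})$ is a finite-dimensional C*-algebra with a Hopf $*$-algebra structure, with comultiplication $\Delta$ and antipode $R$. Let $\psi$ be the tracial $1$-form on $C(\mathbb{G})$: the unique faithful positive tracial functional such that $mm^*=\mathrm{id}$, where $m$ is the multiplication and adjoints are taken with respect to $\langle x,y\rangle=\psi(x^*y)$. It is the suitably normalised Haar functional, namely $\bigoplus_\alpha n_\alpha \mathrm{Tr}_{n_\alpha}$ when $C(\mathbb{G})\cong\bigoplus_\alpha M_{n_\alpha}(\mathbb{C})$. For $x\in C(\mathbb{G})$ let $x\star y=(\psi(R(x)\,\cdot\,)\otimes\mathrm{id})\Delta(y)$. Let $\mathrm{Irr}(\widehat{\mathbb{G}})$ be the set of equivalence classes of irreducible unitary representations of the dual quantum group, that is, of irreducible finite-dimensional $*$-representations of $C(\mathbb{G})$. A set $S\subset\mathrm{Irr}(\widehat{\mathbb{G}})$ is symmetric if $\bar S=S$, and generating if every $\alpha\in\mathrm{Irr}(\widehat{\mathbb{G}})$ is a subobject of a finite tensor product of elements of $S$ (the empty product being the trivial representation). Let $P_S\in C(\mathbb{G})$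 be the central projection that acts as the identity in the representations belonging to $S$ and as zero in the other irreducible ones; $S\mapsto P_S$ identifies subsets of $\mathrm{Irr}(\widehat{\mathbb{G}})$ with central projections, and a central projection $P_S$ is called generating if $S$ is generating. A linear map $A:C(\mathbb{G})\to C(\mathbb{G})$ is a quantum adjacency matrix if $m(A\otimes A)m^*=A$ and $A(x^*)^*=A(x)$ for all $x$, and it is undirected if $A=A^*$. A central undirected quantum Cayley graph on $\mathbb{G}$ is an undirected quantum adjacency matrix of the form $A=P\star(\cdot)$ with $P$ a central projection; it is called generating if $P$ is. The quantum edge correspondence $E_A$ is the separation of the $C(\mathbb{G})$-bimodule $C(\mathbb{G})\otimes C(\mathbb{G})$ with respect to the $C(\mathbb{G})$-valued inner product $\langle a\otimes b,c\otimes d\rangle=b^*A(a^*c)d$ (by finite-dimensionality it is complete). Vergnioux's triple $(K,\mathcal{S},\mathcal{T})$ determined by $P_S$ consists of $K=P_SC(\mathbb{G})\otimes C(\mathbb{G})$ and the maps $\mathcal{S}f=P_S\otimes f$, $\mathcal{T}f=(P_S\otimes 1)\Delta(f)$ from $C(\mathbb{G})$ to $K$; the space $K$ carries the bimodule structure $f\cdot\xi\cdot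 h=\Delta(f)\,\xi\,(1\otimes h)$ and the inner product $\langle\xi|\eta\rangle=(\psi\otimes\mathrm{id})(\xi^*\eta)$. Vergnioux's quantum Cayley graphs on $\mathbb{G}$ are the triples determined by $P_S$ for symmetric generating $S$. **Theorem.** (1) Let $S\subset\mathrm{Irr}(\widehat{\mathbb{G}})$ be symmetric and generating, and let $A=P_S\star(\cdot)$. Then $E_A$ and $K$ are C*-correspondences over $C(\mathbb{G})$, and the formula $$\Phi(a\otimes b)=\Delta(a)(1\otimes b)(P_S\otimes 1),\qquad a,b\in C(\mathbb{G}),$$ gives a well-defined isomorphism of C*-correspondences $\Phi:E_A\to K$ (a linear bijection respecting both actions and the $C(\mathbb{G})$-valued inner products). (2) Consequently there is a bijection from the set of Vergnioux's quantum Cayley graphs on $\mathbb{G}$ onto the set of generating central undirected quantum Cayley graphs on $\mathbb{G}$, which sends the triple determined by $P_S$ to $P_S\star(\cdot)$ for every symmetric generating $S$. Moreover, without the generating condition, $S\mapsto P_S\star(\cdot)$ is a bijection from all symmetric subsets of $\mathrm{Irr}(\widehat{\mathbb{G}})$ onto all central undirected quantum Cayley graphs on $\mathbb{G}$. -/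

import Mathlib

open scoped TensorProduct ComplexConjugate

noncomputable section

universe u

/-! ## Finite quantum sets and quantum graphs -/

section QuantumSets

variable {B : Type u} [CStarAlgebra B]

variable (B) in
/-- The tracial `1`-form `ψ` on a finite-dimensional C*-algebra `B`: the trace of the left
regular representation, `ψ(x) = Tr(y ↦ x y)`. Under an isomorphism of `B` with `⨁ α, M_{n α}(ℂ)` it
is `⨁ α, n α • Tr`. Below it is shown to be tracial, positive and faithful, with `m m* = id`. -/
def oneForm : B →ₗ[ℂ] ℂ := LinearMap.trace ℂ B ∘ₗ (Algebra.lmul ℂ B).toLinearMap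

theorem oneForm_mul_comm (x y : B) : oneForm B (x * y) = oneForm B (y * x) := by
  simp only [oneForm, LinearMap.comp_apply, AlgHom.toLinearMap_apply, map_mul]
  exact LinearMap.trace_mul_comm ℂ _ _

variable [FiniteDimensional ℂ B]

theorem roots_lmul_star_mul_self (x : B) (z : ℂ)
    (hz : z ∈ (LinearMap.charpoly (Algebra.lmul ℂ B (star x * x))).roots) : 0 ≤ z.re ∧ z.im = 0 := by
  have h1 : Module.End.HasEigenvalue (Algebra.lmul ℂ B (star x * x)) z :=
    (Module.End.hasEigenvalue_iff_isRoot_charpoly _ _).2 (Polynomial.isRoot_of_mem_roots hz)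
  have h2 : z ∈ spectrum ℂ (star x * x) :=
    AlgHom.spectrum_apply_subset (Algebra.lmul ℂ B) _ h1.mem_spectrum
  have hsa : IsSelfAdjoint (star x * x) := IsSelfAdjoint.star_mul_self x
  have h3 : z = z.re := hsa.mem_spectrum_eq_re h2
  have h4 : z.re ∈ spectrum ℝ (star x * x) := by
    rw [← spectrum.algebraMap_mem_iff ℂ]
    simpa [← h3] using h2
  exact ⟨spectrum_star_mul_self_nonneg _ h4, by rw [h3]; simp⟩

theorem oneForm_star_mul_self (x : B) :
    oneForm B (star x * x) =
      ((LinearMap.charpoly (Algebra.lmul ℂ B (star x * x))).roots.map Complex.re).sum := by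
  have h : oneForm B (star x * x) =
      (LinearMap.charpoly (Algebra.lmul ℂ B (star x * x))).roots.sum :=
    Module.End.trace_eq_sum_roots_charpoly_of_splits (IsAlgClosed.splits _)
  rw [h, ← Complex.ofRealHom_eq_coe, map_multiset_sum, Multiset.map_map]
  congr 1
  conv_lhs => rw [← Multiset.map_id (LinearMap.charpoly (Algebra.lmul ℂ B (star x * x))).roots]
  refine Multiset.map_congr rfl fun z hz => ?_
  exact Complex.ext (by simp) (by simpa using (roots_lmul_star_mul_self x z hz).2)

theorem oneForm_nonneg (x : B) : 0 ≤ (oneForm B (star x * x)).re := by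
  rw [oneForm_star_mul_self, Complex.ofReal_re]
  refine Multiset.sum_nonneg fun r hr => ?_
  obtain ⟨z, hz, rfl⟩ := Multiset.mem_map.1 hr
  exact (roots_lmul_star_mul_self x z hz).1

theorem oneForm_faithful (x : B) (h : oneForm B (star x * x) = 0) : x = 0 := by
  rw [oneForm_star_mul_self, Complex.ofReal_eq_zero] at h
  have hroot : ∀ z ∈ (LinearMap.charpoly (Algebra.lmul ℂ B (star x * x))).roots, z = 0 := by
    intro z hz
    have h1 := Multiset.all_zero_of_le_zero_le_of_sum_eq_zero (fun r hr => by
      obtain ⟨w, hw, rfl⟩ := Multiset.mem_map.1 hr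
      exact (roots_lmul_star_mul_self x w hw).1) h _ (Multiset.mem_map_of_mem Complex.re hz)
    exact Complex.ext h1 (roots_lmul_star_mul_self x z hz).2
  have hs : IsSelfAdjoint (star x * x) := IsSelfAdjoint.star_mul_self x
  set n := (LinearMap.charpoly (Algebra.lmul ℂ B (star x * x))).roots.card with hn
  have hpow : (star x * x) ^ n = 0 := by
    have hc : LinearMap.charpoly (Algebra.lmul ℂ B (star x * x)) = Polynomial.X ^ n := by
      have h2 := (IsAlgClosed.splits (LinearMap.charpoly
        (Algebra.lmul ℂ B (star x * x)))).eq_prod_roots_of_monic (LinearMap.charpoly_monic _)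
      rw [Multiset.eq_replicate_card.2 hroot] at h2
      rwa [Multiset.map_replicate, Multiset.prod_replicate, Polynomial.C_0, sub_zero] at h2
    have h3 := LinearMap.aeval_self_charpoly (Algebra.lmul ℂ B (star x * x))
    rw [hc, Polynomial.aeval_X_pow, ← map_pow] at h3
    simpa using congrArg (fun f => f 1) h3
  have hnorm : ‖(star x * x) ^ 2 ^ n‖ = ‖star x * x‖ ^ 2 ^ n := hs.norm_pow_two_pow n
  rw [pow_eq_zero_of_le Nat.lt_two_pow_self.le hpow, norm_zero] at hnorm
  have h4 := pow_eq_zero_iff (pow_ne_zero n two_ne_zero) |>.1 hnorm.symm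
  rwa [norm_eq_zero, CStarRing.star_mul_self_eq_zero_iff] at h4

theorem oneForm_im_of_isSelfAdjoint (a : B) (ha : IsSelfAdjoint a) : (oneForm B a).im = 0 := by
  have h1 : (oneForm B (star (a + 1) * (a + 1))).im = 0 := by
    rw [oneForm_star_mul_self, Complex.ofReal_im]
  have h2 : (oneForm B (star a * a)).im = 0 := by rw [oneForm_star_mul_self, Complex.ofReal_im]
  have h3 : (oneForm B (star (1 : B) * 1)).im = 0 := by
    rw [oneForm_star_mul_self, Complex.ofReal_im]
  simp only [star_add, star_one, ha.star_eq, add_mul, mul_add, mul_one, one_mul, map_add,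
    Complex.add_im] at h1 h2 h3
  linarith

theorem oneForm_star (a : B) : oneForm B (star a) = conj (oneForm B a) := by
  have hre : (oneForm B (a + star a)).im = 0 :=
    oneForm_im_of_isSelfAdjoint _ (IsSelfAdjoint.add_star_self a)
  have him : (oneForm B (Complex.I • (a - star a))).im = 0 :=
    oneForm_im_of_isSelfAdjoint _ (by
      rw [isSelfAdjoint_iff, star_smul, star_sub, star_star, Complex.star_def, Complex.conj_I,
        neg_smul, ← smul_neg, neg_sub])
  simp only [map_add, map_sub, map_smul, smul_eq_mul, Complex.add_im, Complex.mul_im,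
    Complex.I_re, Complex.I_im, Complex.sub_re, zero_mul, one_mul, zero_add] at hre him
  exact Complex.ext (by simp; linarith) (by simp; linarith)

variable (B) in
/-- The Hilbert space `ℓ²` of the finite quantum set with function algebra `B`: the vector space `B`
with the inner product `⟨x, y⟩ = ψ(x* y)`. -/
def L2 : Type u := B

instance : AddCommGroup (L2 B) := inferInstanceAs (AddCommGroup B)

instance : Module ℂ (L2 B) := inferInstanceAs (Module ℂ B)

instance : FiniteDimensional ℂ (L2 B) := inferInstanceAs (FiniteDimensional ℂ B)

variable (B) in
/-- The identification of `B` with `ℓ²` as vector spaces. -/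
def toL2 : B ≃ₗ[ℂ] L2 B := LinearEquiv.refl ℂ B

/-- The inner product `⟨x, y⟩ = ψ(x* y)`. -/
@[reducible] def L2.core : InnerProductSpace.Core ℂ (L2 B) where
  inner x y := oneForm B (star ((toL2 B).symm x) * (toL2 B).symm y)
  conj_inner_symm x y := by rw [← oneForm_star, star_mul, star_star]
  re_inner_nonneg x := oneForm_nonneg _
  add_left x y z := by simp [add_mul]
  smul_left x y r := by simp
  definite x h := by simpa using oneForm_faithful _ h

instance : NormedAddCommGroup (L2 B) := L2.core.toNormedAddCommGroup

instance : InnerProductSpace ℂ (L2 B) := InnerProductSpace.ofCore L2.core.toCore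

theorem L2.inner_def (x y : B) :
    inner ℂ (toL2 B x) (toL2 B y) = oneForm B (star x * y) := rfl

/-- The adjoint `A*` of a linear map `A : B → B` with respect to `⟨x, y⟩ = ψ(x* y)`. -/
def adj (A : B →ₗ[ℂ] B) : B →ₗ[ℂ] B :=
  (toL2 B).symm.toLinearMap ∘ₗ
    LinearMap.adjoint ((toL2 B).toLinearMap ∘ₗ A ∘ₗ (toL2 B).symm.toLinearMap) ∘ₗ
      (toL2 B).toLinearMap

variable (B) in
/-- The adjoint `m* : B → B ⊗ B` of the multiplication map `m : B ⊗ B → B`, where `B` and `B ⊗ B`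
carry the Hilbert space structures of `ℓ²` and `ℓ² ⊗ ℓ²`. -/
def mulAdjoint : B →ₗ[ℂ] B ⊗[ℂ] B :=
  TensorProduct.map (toL2 B).symm.toLinearMap (toL2 B).symm.toLinearMap ∘ₗ
    LinearMap.adjoint ((toL2 B).toLinearMap ∘ₗ LinearMap.mul' ℂ B ∘ₗ
      TensorProduct.map (toL2 B).symm.toLinearMap (toL2 B).symm.toLinearMap) ∘ₗ
        (toL2 B).toLinearMap

theorem inner_mulAdjoint (a c y : B) :
    inner ℂ (toL2 B a ⊗ₜ[ℂ] toL2 B c)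
      (TensorProduct.map (toL2 B).toLinearMap (toL2 B).toLinearMap (mulAdjoint B y)) =
        inner ℂ (toL2 B (a * c)) (toL2 B y) := by
  have h : TensorProduct.map (toL2 B).toLinearMap (toL2 B).toLinearMap (mulAdjoint B y) =
      LinearMap.adjoint ((toL2 B).toLinearMap ∘ₗ LinearMap.mul' ℂ B ∘ₗ
        TensorProduct.map (toL2 B).symm.toLinearMap (toL2 B).symm.toLinearMap) (toL2 B y) := by
    simp only [mulAdjoint, LinearMap.comp_apply]
    rw [← LinearMap.comp_apply, ← TensorProduct.map_comp]
    simp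
  rw [h, LinearMap.adjoint_inner_right]
  simp

theorem mulAdjoint_apply {ι : Type*} [Fintype ι] (e : OrthonormalBasis ι ℂ (L2 B)) (y : B) :
    mulAdjoint B y =
      ∑ i, (toL2 B).symm (e i) ⊗ₜ[ℂ] (star ((toL2 B).symm (e i)) * y) := by
  have hinj : Function.Injective
      (TensorProduct.map (toL2 B).toLinearMap (toL2 B).toLinearMap) :=
    (TensorProduct.congr (toL2 B) (toL2 B)).injective
  apply hinj
  rw [TensorProduct.ext_iff_inner_left]
  intro a c
  obtain ⟨a, rfl⟩ := (toL2 B).surjective a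
  obtain ⟨c, rfl⟩ := (toL2 B).surjective c
  rw [inner_mulAdjoint, map_sum, inner_sum]
  simp only [TensorProduct.map_tmul, LinearEquiv.coe_coe, TensorProduct.inner_tmul,
    LinearEquiv.apply_symm_apply]
  have h : ∀ i, inner ℂ (toL2 B c) (toL2 B (star ((toL2 B).symm (e i)) * y)) =
      inner ℂ (e i) (toL2 B (y * star c)) := by
    intro i
    have h1 := L2.inner_def ((toL2 B).symm (e i)) (y * star c)
    rw [LinearEquiv.apply_symm_apply] at h1
    rw [h1, L2.inner_def, oneForm_mul_comm, mul_assoc]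
  simp only [h]
  rw [e.sum_inner_mul_inner, L2.inner_def, L2.inner_def, star_mul, mul_assoc, oneForm_mul_comm,
    mul_assoc]

/-- The normalisation `m m* = id`: the functional `ψ` is a `1`-form. -/
theorem mul_mulAdjoint (y : B) : LinearMap.mul' ℂ B (mulAdjoint B y) = y := by
  set e := stdOrthonormalBasis ℂ (L2 B)
  set c : B := ∑ i, (toL2 B).symm (e i) * star ((toL2 B).symm (e i)) with hc
  have h1 : ∀ z, LinearMap.mul' ℂ B (mulAdjoint B z) = c * z := by
    intro z
    rw [mulAdjoint_apply e, map_sum, hc, Finset.sum_mul]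
    simp [mul_assoc]
  have h2 : ∀ z, oneForm B (c * z) = oneForm B z := by
    intro z
    have h3 : oneForm B z = ∑ i, inner ℂ (e i) (toL2 B (z * (toL2 B).symm (e i))) := by
      have h4 := LinearMap.trace_eq_sum_inner
        ((toL2 B).toLinearMap ∘ₗ Algebra.lmul ℂ B z ∘ₗ (toL2 B).symm.toLinearMap) e
      have h5 := LinearMap.trace_conj' (Algebra.lmul ℂ B z) (toL2 B)
      rw [LinearEquiv.conj_apply, LinearMap.comp_assoc] at h5
      rw [h5] at h4
      exact h4
    rw [h3, hc, Finset.sum_mul, map_sum]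
    refine Finset.sum_congr rfl fun i _ => ?_
    have h5 := L2.inner_def ((toL2 B).symm (e i)) (z * (toL2 B).symm (e i))
    rw [LinearEquiv.apply_symm_apply] at h5
    rw [h5, mul_assoc, oneForm_mul_comm, mul_assoc]
  have h3 : c - 1 = 0 := by
    rw [← star_eq_zero]
    apply oneForm_faithful
    rw [star_star, sub_mul, one_mul, map_sub, h2, sub_self]
  rw [h1, sub_eq_zero.1 h3, one_mul]

/-- The Schur product `A₁ • A₂ = m (A₁ ⊗ A₂) m*`. -/
def schurProduct (A₁ A₂ : B →ₗ[ℂ] B) : B →ₗ[ℂ] B :=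
  LinearMap.mul' ℂ B ∘ₗ TensorProduct.map A₁ A₂ ∘ₗ mulAdjoint B

/-- `A` is a quantum adjacency matrix, that is, `(B, A)` is a quantum graph: `A • A = A` and
`A = Ā`, where `Ā x = (A x*)*`. -/
structure IsQuantumGraph (A : B →ₗ[ℂ] B) : Prop where
  schur_idempotent : schurProduct A A = A
  real : ∀ x, star (A (star x)) = A x

/-- A quantum graph is undirected if `A = A*`. -/
def IsUndirected (A : B →ₗ[ℂ] B) : Prop := adj A = A

end QuantumSets

/-! ## C*-correspondences -/

section Correspondences

variable {B : Type u} [CStarAlgebra B]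

/-- The data of a correspondence over `B` on a complex vector space `E`: left and right actions
and a `B`-valued inner product, written `⟨ξ | η⟩`. -/
structure CorrespondenceData (B : Type u) [CStarAlgebra B] (E : Type*) where
  left : B → E → E
  right : E → B → E
  inner : E → E → B

/-- The data `D` form a C*-correspondence over the unital C*-algebra `B`: `E` is a right Hilbert
C*-module over `B` (inner product linear in the second variable, complete in the norm
`‖⟨ξ | ξ⟩‖ ^ (1/2)`) on which `B` acts from the left by a unital `*`-homomorphism into the
adjointable operators. -/
structure IsCStarCorrespondence {E : Type*} [AddCommGroup E] [Module ℂ E]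
    (D : CorrespondenceData B E) : Prop where
  right_add : ∀ ξ η b, D.right (ξ + η) b = D.right ξ b + D.right η b
  right_smul : ∀ (z : ℂ) ξ b, D.right (z • ξ) b = z • D.right ξ b
  right_add' : ∀ ξ b c, D.right ξ (b + c) = D.right ξ b + D.right ξ c
  right_smul' : ∀ (z : ℂ) ξ b, D.right ξ (z • b) = z • D.right ξ b
  right_mul : ∀ ξ b c, D.right ξ (b * c) = D.right (D.right ξ b) c
  right_one : ∀ ξ, D.right ξ 1 = ξ
  inner_add : ∀ ξ η ζ, D.inner ξ (η + ζ) = D.inner ξ η + D.inner ξ ζ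
  inner_smul : ∀ (z : ℂ) ξ η, D.inner ξ (z • η) = z • D.inner ξ η
  inner_right : ∀ ξ η b, D.inner ξ (D.right η b) = D.inner ξ η * b
  star_inner : ∀ ξ η, star (D.inner ξ η) = D.inner η ξ
  /-- Positivity: elements of the form `b* b` are exactly the positive elements of `B`. -/
  inner_self_nonneg : ∀ ξ, ∃ b, D.inner ξ ξ = star b * b
  inner_self_eq_zero : ∀ ξ, D.inner ξ ξ = 0 → ξ = 0
  complete : ∀ u : ℕ → E,
    (∀ ε > 0, ∃ N, ∀ m ≥ N, ∀ n ≥ N, ‖D.inner (u m - u n) (u m - u n)‖ < ε) →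
      ∃ ξ, Filter.Tendsto (fun n => ‖D.inner (u n - ξ) (u n - ξ)‖) Filter.atTop (nhds 0)
  left_add : ∀ b ξ η, D.left b (ξ + η) = D.left b ξ + D.left b η
  left_smul : ∀ b (z : ℂ) ξ, D.left b (z • ξ) = z • D.left b ξ
  left_add' : ∀ b c ξ, D.left (b + c) ξ = D.left b ξ + D.left c ξ
  left_smul' : ∀ (z : ℂ) b ξ, D.left (z • b) ξ = z • D.left b ξ
  left_mul : ∀ b c ξ, D.left (b * c) ξ = D.left b (D.left c ξ)
  left_one : ∀ ξ, D.left 1 ξ = ξ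
  left_right : ∀ b ξ c, D.left b (D.right ξ c) = D.right (D.left b ξ) c
  inner_left : ∀ b ξ η, D.inner (D.left b ξ) η = D.inner ξ (D.left (star b) η)

/-- A linear bijection is an isomorphism of correspondences if it respects both actions and the
`B`-valued inner products. -/
structure IsCorrespondenceIso {E F : Type*} [AddCommGroup E] [Module ℂ E] [AddCommGroup F]
    [Module ℂ F] (D : CorrespondenceData B E) (D' : CorrespondenceData B F)
    (Φ : E ≃ₗ[ℂ] F) : Prop where
  map_left : ∀ b ξ, Φ (D.left b ξ) = D'.left b (Φ ξ)
  map_right : ∀ ξ b, Φ (D.right ξ b) = D'.right (Φ ξ) b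
  inner_map : ∀ ξ η, D'.inner (Φ ξ) (Φ η) = D.inner ξ η

end Correspondences

/-! ## The quantum edge correspondence -/

section EdgeCorrespondence

variable {B : Type u} [CStarAlgebra B]

/-- The bilinear map `(a ⊗ b, c ⊗ d) ↦ b A(a c) d` on `B ⊗ B`. -/
def edgeForm (A : B →ₗ[ℂ] B) : B ⊗[ℂ] B →ₗ[ℂ] B ⊗[ℂ] B →ₗ[ℂ] B :=
  TensorProduct.lift (LinearMap.mk₂ ℂ
    (fun a b => LinearMap.mulLeft ℂ b ∘ₗ LinearMap.mul' ℂ B ∘ₗ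
      TensorProduct.map (A ∘ₗ LinearMap.mulLeft ℂ a) LinearMap.id)
    (fun a₁ a₂ b => by ext c d; simp [add_mul, mul_add])
    (fun z a b => by ext c d; simp)
    (fun a b₁ b₂ => by ext c d; simp [add_mul])
    (fun z a b => by ext c d; simp))

/-- The `B`-valued sesquilinear form on `B ⊗ B` with
`⟨a ⊗ b, c ⊗ d⟩ = b* A(a* c) d`. -/
def edgeInner (A : B →ₗ[ℂ] B) (ξ η : B ⊗[ℂ] B) : B := edgeForm A (star ξ) η

theorem edgeInner_tmul (A : B →ₗ[ℂ] B) (a b c d : B) :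
    edgeInner A (a ⊗ₜ b) (c ⊗ₜ d) = star b * A (star a * c) * d := by
  simp [edgeInner, edgeForm, mul_assoc]

theorem edgeInner_left (A : B →ₗ[ℂ] B) (f : B) (ξ η : B ⊗[ℂ] B) :
    edgeInner A ((f ⊗ₜ 1) * ξ) η = edgeInner A ξ ((star f ⊗ₜ 1) * η) := by
  induction ξ with
  | zero => simp [edgeInner]
  | add ξ₁ ξ₂ h₁ h₂ => simp only [edgeInner, mul_add, star_add, map_add,
      LinearMap.add_apply] at h₁ h₂ ⊢; rw [h₁, h₂]
  | tmul a b =>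
    induction η with
    | zero => simp [edgeInner]
    | add η₁ η₂ h₁ h₂ => simp only [edgeInner, mul_add, map_add] at h₁ h₂ ⊢; rw [h₁, h₂]
    | tmul c d => simp [edgeInner_tmul, mul_assoc]

theorem edgeInner_right (A : B →ₗ[ℂ] B) (f : B) (ξ η : B ⊗[ℂ] B) :
    edgeInner A ξ (η * (1 ⊗ₜ f)) = edgeInner A ξ η * f := by
  induction ξ with
  | zero => simp [edgeInner]
  | add ξ₁ ξ₂ h₁ h₂ => simp only [edgeInner, star_add, map_add, LinearMap.add_apply,
      add_mul] at h₁ h₂ ⊢; rw [h₁, h₂]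
  | tmul a b =>
    induction η with
    | zero => simp [edgeInner]
    | add η₁ η₂ h₁ h₂ => simp only [edgeInner, add_mul, map_add] at h₁ h₂ ⊢; rw [h₁, h₂]
    | tmul c d => simp [edgeInner_tmul, mul_assoc]

theorem edgeInner_right' (A : B →ₗ[ℂ] B) (f : B) (ξ η : B ⊗[ℂ] B) :
    edgeInner A (ξ * (1 ⊗ₜ f)) η = star f * edgeInner A ξ η := by
  induction ξ with
  | zero => simp [edgeInner]
  | add ξ₁ ξ₂ h₁ h₂ => simp only [edgeInner, star_add, map_add, LinearMap.add_apply,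
      add_mul, mul_add] at h₁ h₂ ⊢; rw [h₁, h₂]
  | tmul a b =>
    induction η with
    | zero => simp [edgeInner]
    | add η₁ η₂ h₁ h₂ => simp only [edgeInner, mul_add, map_add] at h₁ h₂ ⊢; rw [h₁, h₂]
    | tmul c d => simp [edgeInner_tmul, mul_assoc]

/-- The radical of the form `edgeInner A`. When the form is positive semidefinite, as it is for a
quantum adjacency matrix `A`, the Cauchy–Schwarz inequality identifies it with the set of all `ξ`
with `⟨ξ, ξ⟩ = 0`. -/
def edgeNull (A : B →ₗ[ℂ] B) : Submodule ℂ (B ⊗[ℂ] B) where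
  carrier := {ξ | ∀ η, edgeInner A ξ η = 0 ∧ edgeInner A η ξ = 0}
  zero_mem' η := by simp [edgeInner]
  add_mem' {ξ₁ ξ₂} h₁ h₂ η := by
    have h3 := h₁ η
    have h4 := h₂ η
    simp only [edgeInner] at h3 h4 ⊢
    simp [h3.1, h3.2, h4.1, h4.2]
  smul_mem' z ξ h η := by
    have h3 := h η
    simp only [edgeInner] at h3 ⊢
    simp [h3.1, h3.2]

/-- The separation `C(𝕏) ⊗_A C(𝕏)` of `B ⊗ B` with respect to `edgeInner A`. Since `B` is
finite-dimensional in all applications, it is already complete. -/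
abbrev EdgeSpace (A : B →ₗ[ℂ] B) : Type u := (B ⊗[ℂ] B) ⧸ edgeNull A

/-- The quantum edge correspondence `E_A` of `(B, A)`: the separation of the `B`-bimodule `B ⊗ B`,
with `f · (a ⊗ b) · h = f a ⊗ b h`, with respect to `⟨a ⊗ b, c ⊗ d⟩ = b* A(a* c) d`. -/
def edgeCorrespondence (A : B →ₗ[ℂ] B) : CorrespondenceData B (EdgeSpace A) where
  left f := (edgeNull A).mapQ (edgeNull A) (LinearMap.mulLeft ℂ (f ⊗ₜ 1)) (by
    intro ξ hξ η
    refine ⟨?_, ?_⟩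
    · rw [LinearMap.mulLeft_apply, edgeInner_left]
      exact (hξ _).1
    · have h := edgeInner_left A (star f) η ξ
      rw [star_star] at h
      rw [LinearMap.mulLeft_apply, ← h]
      exact (hξ _).2)
  right ξ f := (edgeNull A).mapQ (edgeNull A) (LinearMap.mulRight ℂ (1 ⊗ₜ f)) (by
    intro ξ hξ η
    refine ⟨?_, ?_⟩
    · rw [LinearMap.mulRight_apply, edgeInner_right', (hξ η).1, mul_zero]
    · rw [LinearMap.mulRight_apply, edgeInner_right, (hξ η).2, zero_mul]) ξ
  inner := Quotient.lift₂ (edgeInner A) (by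
    intro ξ η ξ' η' h₁ h₂
    have h₁' := (Submodule.quotientRel_def _).1 h₁
    have h₂' := (Submodule.quotientRel_def _).1 h₂
    have e₁ := (h₁' η).1
    have e₂ := (h₂' ξ').2
    simp only [edgeInner, star_sub, map_sub, LinearMap.sub_apply, sub_eq_zero] at e₁ e₂ ⊢
    rw [e₁, e₂])

end EdgeCorrespondence

/-! ## Finite quantum groups -/

/-- A finite quantum group, given by its function algebra `H = C(𝔾)`: a finite-dimensional
C*-algebra with the structure of a Hopf `*`-algebra. -/
class FiniteQuantumGroup (H : Type u) [CStarAlgebra H] extends Coalgebra ℂ H where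
  finiteDimensional : FiniteDimensional ℂ H
  counit_one : counit 1 = 1
  counit_mul : ∀ a b : H, counit (a * b) = counit a * counit b
  counit_star : ∀ a : H, counit (star a) = star (counit a)
  comul_one : comul 1 = 1
  comul_mul : ∀ a b : H, comul (a * b) = comul a * comul b
  comul_star : ∀ a : H, comul (star a) = star (comul a)
  antipode : H →ₗ[ℂ] H
  mul_antipode_rTensor_comul :
    LinearMap.mul' ℂ H ∘ₗ antipode.rTensor H ∘ₗ comul = Algebra.linearMap ℂ H ∘ₗ counit
  mul_antipode_lTensor_comul :
    LinearMap.mul' ℂ H ∘ₗ antipode.lTensor H ∘ₗ comul = Algebra.linearMap ℂ H ∘ₗ counit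

namespace FiniteQuantumGroup

variable {H : Type u} [CStarAlgebra H] [FiniteQuantumGroup H]

instance : FiniteDimensional ℂ H := finiteDimensional

/-- The underlying Hopf algebra in the sense of Mathlib. -/
@[reducible] def hopfAlgebra (H : Type u) [CStarAlgebra H] [FiniteQuantumGroup H] :
    HopfAlgebra ℂ H where
  toBialgebra := Bialgebra.mk' ℂ H counit_one (fun {_ _} => counit_mul _ _) comul_one
    (fun {_ _} => comul_mul _ _)
  antipode := antipode
  mul_antipode_rTensor_comul := mul_antipode_rTensor_comul
  mul_antipode_lTensor_comul := mul_antipode_lTensor_comul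

variable (H) in
/-- The comultiplication `Δ` as a `*`-homomorphism. -/
def Δ : H →⋆ₐ[ℂ] H ⊗[ℂ] H where
  __ := AlgHom.ofLinearMap (Coalgebra.comul (R := ℂ) (A := H)) comul_one comul_mul
  map_star' := comul_star

variable (H) in
/-- The counit as a `*`-homomorphism. -/
def ε : H →⋆ₐ[ℂ] ℂ where
  __ := AlgHom.ofLinearMap (Coalgebra.counit (R := ℂ) (A := H)) counit_one counit_mul
  map_star' := counit_star

end FiniteQuantumGroup

open FiniteQuantumGroup

/-! ## Representations of the dual quantum group -/

section Representations

variable (H : Type u) [CStarAlgebra H] [FiniteQuantumGroup H]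

/-- A finite-dimensional unitary representation of the dual quantum group of `𝔾`, that is, a
finite-dimensional `*`-representation of `H = C(𝔾)`. -/
structure UnitaryRep where
  dim : ℕ
  hom : H →⋆ₐ[ℂ] Matrix (Fin dim) (Fin dim) ℂ

namespace UnitaryRep

/-- The trivial representation, given by the counit. -/
def trivial : UnitaryRep H where
  dim := 1
  hom := (StarAlgHom.ofId ℂ (Matrix (Fin 1) (Fin 1) ℂ)).comp (ε H)

variable {H}

/-- The tensor product of representations, `a ↦ (π ⊗ ρ) Δ(a)`. -/
def tensor (π ρ : UnitaryRep H) : UnitaryRep H where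
  dim := π.dim * ρ.dim
  hom :=
    { __ := (Matrix.reindexAlgEquiv ℂ ℂ finProdFinEquiv).toAlgHom.comp
        ((Matrix.kroneckerAlgEquiv (Fin π.dim) (Fin ρ.dim) ℂ).toAlgHom.comp
          ((Algebra.TensorProduct.map π.hom.toAlgHom ρ.hom.toAlgHom).comp (Δ H).toAlgHom))
      map_star' := by
        intro a
        have h1 : ∀ t : H ⊗[ℂ] H,
            Algebra.TensorProduct.map π.hom.toAlgHom ρ.hom.toAlgHom (star t) =
              star (Algebra.TensorProduct.map π.hom.toAlgHom ρ.hom.toAlgHom t) := by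
          intro t
          induction t with
          | zero => simp
          | tmul x y => simp [map_star π.hom x, map_star ρ.hom y]
          | add x y hx hy => simp only [star_add, map_add, hx, hy]
        have h2 : ∀ t, Matrix.kroneckerAlgEquiv (Fin π.dim) (Fin ρ.dim) ℂ (star t) =
            star (Matrix.kroneckerAlgEquiv (Fin π.dim) (Fin ρ.dim) ℂ t) :=
          fun t => map_star (Matrix.kroneckerStarAlgEquiv (Fin π.dim) (Fin ρ.dim) ℂ) t
        have h3 : ∀ M : Matrix (Fin π.dim × Fin ρ.dim) (Fin π.dim × Fin ρ.dim) ℂ,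
            Matrix.reindexAlgEquiv ℂ ℂ finProdFinEquiv (star M) =
              star (Matrix.reindexAlgEquiv ℂ ℂ finProdFinEquiv M) := fun M => rfl
        have h4 : Δ H (star a) = star (Δ H a) := map_star _ _
        change Matrix.reindexAlgEquiv ℂ ℂ finProdFinEquiv
          (Matrix.kroneckerAlgEquiv (Fin π.dim) (Fin ρ.dim) ℂ
            (Algebra.TensorProduct.map π.hom.toAlgHom ρ.hom.toAlgHom (Δ H (star a)))) =
          star (Matrix.reindexAlgEquiv ℂ ℂ finProdFinEquiv
            (Matrix.kroneckerAlgEquiv (Fin π.dim) (Fin ρ.dim) ℂ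
              (Algebra.TensorProduct.map π.hom.toAlgHom ρ.hom.toAlgHom (Δ H a))))
        rw [h4, h1, h2, h3] }

/-- The tensor product of a finite sequence of representations; the empty tensor product is the
trivial representation. -/
def tensorList (l : List (UnitaryRep H)) : UnitaryRep H :=
  l.foldr tensor (trivial H)

/-- `π` is irreducible: it is nonzero and has no invariant subspace other than `0` and the whole
space. -/
def IsIrreducible (π : UnitaryRep H) : Prop :=
  0 < π.dim ∧ ∀ W : Submodule ℂ (Fin π.dim → ℂ),
    (∀ a, ∀ v ∈ W, (π.hom a).mulVec v ∈ W) → W = ⊥ ∨ W = ⊤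

/-- `π` is (equivalent to) a subobject of `ρ`: there is an isometric intertwiner from `π` to `ρ`. -/
def IsSubobject (π ρ : UnitaryRep H) : Prop :=
  ∃ V : Matrix (Fin ρ.dim) (Fin π.dim) ℂ, V.conjTranspose * V = 1 ∧
    ∀ a, V * π.hom a = ρ.hom a * V

/-- Unitary equivalence of representations. -/
def IsEquivalent (π ρ : UnitaryRep H) : Prop :=
  ∃ V : Matrix (Fin ρ.dim) (Fin π.dim) ℂ, V.conjTranspose * V = 1 ∧ V * V.conjTranspose = 1 ∧
    ∀ a, V * π.hom a = ρ.hom a * V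

/-- `ρ` is a conjugate (contragredient) of `π`: it is equivalent to the representation
`a ↦ π(S(a))ᵀ`, where `S` is the antipode. -/
def IsConjugate (π ρ : UnitaryRep H) : Prop :=
  ∃ (T : Matrix (Fin π.dim) (Fin ρ.dim) ℂ) (T' : Matrix (Fin ρ.dim) (Fin π.dim) ℂ),
    T * T' = 1 ∧ T' * T = 1 ∧
      ∀ a, T * ρ.hom a = (π.hom (antipode a)).transpose * T

end UnitaryRep

/-- Irreducible unitary representations of the dual quantum group. -/
def IrredRep : Type u := {π : UnitaryRep H // π.IsIrreducible}

instance IrredRep.setoid : Setoid (IrredRep H) where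
  r π ρ := π.1.IsEquivalent ρ.1
  iseqv :=
    { refl := fun π => ⟨1, by simp, by simp, by simp⟩
      symm := by
        rintro π ρ ⟨V, h1, h2, h3⟩
        refine ⟨V.conjTranspose, by simpa using h2, by simpa using h1, fun a => ?_⟩
        calc V.conjTranspose * ρ.1.hom a
            = V.conjTranspose * (ρ.1.hom a * V) * V.conjTranspose := by
              rw [Matrix.mul_assoc, Matrix.mul_assoc, h2, Matrix.mul_one]
          _ = (V.conjTranspose * V) * π.1.hom a * V.conjTranspose := by
              rw [← h3]; simp only [Matrix.mul_assoc]
          _ = π.1.hom a * V.conjTranspose := by rw [h1, Matrix.one_mul]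
      trans := by
        rintro π ρ σ ⟨V, h1, h2, h3⟩ ⟨W, k1, k2, k3⟩
        refine ⟨W * V, ?_, ?_, fun a => ?_⟩
        · rw [Matrix.conjTranspose_mul, Matrix.mul_assoc, ← Matrix.mul_assoc _ W, k1,
            Matrix.one_mul, h1]
        · rw [Matrix.conjTranspose_mul, Matrix.mul_assoc, ← Matrix.mul_assoc V, h2,
            Matrix.one_mul, k2]
        · rw [Matrix.mul_assoc, h3, ← Matrix.mul_assoc, k3, Matrix.mul_assoc] }

/-- The set of equivalence classes of irreducible representations of the dual quantum group. -/
def Irr : Type u := Quotient (IrredRep.setoid H)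

variable {H}

/-- The class of an irreducible representation. -/
def IrredRep.cls (π : IrredRep H) : Irr H := Quotient.mk _ π

/-- The set of classes conjugate to the members of `S`. -/
def conjSet (S : Set (Irr H)) : Set (Irr H) :=
  {β | ∃ π ρ : IrredRep H, π.cls ∈ S ∧ ρ.cls = β ∧ π.1.IsConjugate ρ.1}

/-- `S` is symmetric, `S̄ = S`. -/
def IsSymmetric (S : Set (Irr H)) : Prop := conjSet S = S

/-- `S` is generating: every irreducible representation is a subobject of a tensor product of
members of `S`. -/
def IsGenerating (S : Set (Irr H)) : Prop :=
  ∀ π : IrredRep H, ∃ l : List (IrredRep H), (∀ ρ ∈ l, ρ.cls ∈ S) ∧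
    π.1.IsSubobject (UnitaryRep.tensorList (l.map Subtype.val))

end Representations

/-! ## Quantum Cayley graphs -/

section Cayley

variable (H : Type u) [CStarAlgebra H]

/-- Central orthogonal projections in `H = C(𝔾)`. -/
structure CentralProjection where
  val : H
  isStarProjection : IsStarProjection val
  central : ∀ a, val * a = a * val

instance : Inhabited (CentralProjection H) := ⟨⟨0, ⟨by simp [IsIdempotentElem], by simp⟩, by simp⟩⟩

variable {H} [FiniteQuantumGroup H]

/-- The central projection `P_S` associated with `S`: the unique central projection which is mapped
to the identity by the irreducible representations with class in `S` and to zero by the others. -/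
def centralProjection (S : Set (Irr H)) : CentralProjection H :=
  Classical.epsilon fun P : CentralProjection H => ∀ π : IrredRep H,
    (π.cls ∈ S → π.1.hom P.val = 1) ∧ (π.cls ∉ S → π.1.hom P.val = 0)

/-- The subset of `Irr` associated with a central projection: the classes of those irreducible
representations that do not vanish on it. -/
def CentralProjection.supp (P : CentralProjection H) : Set (Irr H) :=
  {α | ∃ π : IrredRep H, π.cls = α ∧ π.1.hom P.val ≠ 0}

/-- The functional `ψ_x`, `ψ_x(y) = ψ(x y)`. -/
def density (x : H) : H →ₗ[ℂ] ℂ := oneForm H ∘ₗ LinearMap.mulLeft ℂ x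

/-- The operator `L_ω = (ω ⊗ id) Δ`. -/
def leftConv (ω : H →ₗ[ℂ] ℂ) : H →ₗ[ℂ] H :=
  (TensorProduct.lid ℂ H).toLinearMap ∘ₗ ω.rTensor H ∘ₗ Coalgebra.comul

/-- The convolution operator `x ⋆ · = L_{ψ_{S(x)}}`, where `S` is the antipode. -/
def convolution (x : H) : H →ₗ[ℂ] H := leftConv (density (antipode x))

/-- `A` is the adjacency matrix of a central undirected quantum Cayley graph on `𝔾`: it is an
undirected quantum adjacency matrix of the form `A = P ⋆ ·` with a central projection `P`. -/
def IsCentralUndirectedCayley (A : H →ₗ[ℂ] H) : Prop :=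
  IsQuantumGraph A ∧ IsUndirected A ∧ ∃ P : CentralProjection H, A = convolution P.val

/-- A central undirected quantum Cayley graph whose central projection is generating. -/
def IsGeneratingCentralUndirectedCayley (A : H →ₗ[ℂ] H) : Prop :=
  IsQuantumGraph A ∧ IsUndirected A ∧
    ∃ P : CentralProjection H, A = convolution P.val ∧ IsGenerating P.supp

end Cayley

/-! ## Vergnioux's quantum Cayley graphs -/

section Vergnioux

variable {H : Type u} [CStarAlgebra H]

theorem CentralProjection.commute_tmul_one (P : CentralProjection H) (t : H ⊗[ℂ] H) :
    (P.val ⊗ₜ[ℂ] (1 : H)) * t = t * (P.val ⊗ₜ[ℂ] (1 : H)) := by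
  induction t with
  | zero => simp
  | tmul a b => simp [P.central a]
  | add x y hx hy => rw [mul_add, add_mul, hx, hy]

/-- The space `P C(𝔾) ⊗ C(𝔾) = (P ⊗ 1)(C(𝔾) ⊗ C(𝔾))`. -/
def edgeModule (P : CentralProjection H) : Submodule ℂ (H ⊗[ℂ] H) :=
  LinearMap.range (LinearMap.mulLeft ℂ (P.val ⊗ₜ[ℂ] (1 : H)))

theorem edgeModule_mul_mem (P : CentralProjection H) {ξ : H ⊗[ℂ] H} (hξ : ξ ∈ edgeModule P)
    (t : H ⊗[ℂ] H) : ξ * t ∈ edgeModule P := by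
  obtain ⟨η, rfl⟩ := hξ
  exact ⟨η * t, by simp [mul_assoc]⟩

theorem mul_edgeModule_mem (P : CentralProjection H) {ξ : H ⊗[ℂ] H} (hξ : ξ ∈ edgeModule P)
    (t : H ⊗[ℂ] H) : t * ξ ∈ edgeModule P := by
  obtain ⟨η, rfl⟩ := hξ
  refine ⟨t * η, ?_⟩
  simp only [LinearMap.mulLeft_apply]
  rw [← mul_assoc, P.commute_tmul_one, mul_assoc]

variable [FiniteQuantumGroup H]

variable (H) in
/-- The shape of a triple `(K, 𝒮, 𝒯)`: a subspace `K` of `C(𝔾) ⊗ C(𝔾)` with linear source and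
target maps `C(𝔾) → K`. -/
structure GraphTriple where
  space : Submodule ℂ (H ⊗[ℂ] H)
  source : H →ₗ[ℂ] space
  target : H →ₗ[ℂ] space

/-- Vergnioux's triple `(K, 𝒮, 𝒯)` of a central projection: `K = P C(𝔾) ⊗ C(𝔾)`,
`𝒮 f = P ⊗ f` and `𝒯 f = (P ⊗ 1) Δ(f)`. -/
def vergniouxTriple (P : CentralProjection H) : GraphTriple H where
  space := edgeModule P
  source := (TensorProduct.mk ℂ H H P.val).codRestrict _ fun f => ⟨1 ⊗ₜ f, by simp⟩
  target := (LinearMap.mulLeft ℂ (P.val ⊗ₜ[ℂ] (1 : H)) ∘ₗ Coalgebra.comul).codRestrict _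
    fun f => ⟨Coalgebra.comul f, by simp⟩

/-- `Γ` is one of Vergnioux's quantum Cayley graphs: the triple determined by a symmetric
generating set of irreducible representations of the dual. -/
def IsVergniouxGraph (Γ : GraphTriple H) : Prop :=
  ∃ S : Set (Irr H), IsSymmetric S ∧ IsGenerating S ∧ Γ = vergniouxTriple (centralProjection S)

/-- The correspondence `K` of Vergnioux's triple: the actions are `f · ξ = Δ(f) ξ` and
`ξ · h = ξ (1 ⊗ h)`, the inner product is `⟨ξ | η⟩ = (ψ ⊗ id)(ξ* η)`. -/
def vergniouxCorrespondence (P : CentralProjection H) :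
    CorrespondenceData H (vergniouxTriple P).space where
  left f ξ := ⟨Δ H f * ξ.1, mul_edgeModule_mem P ξ.2 _⟩
  right ξ h := ⟨ξ.1 * (1 ⊗ₜ h), edgeModule_mul_mem P ξ.2 _⟩
  inner ξ η := TensorProduct.lid ℂ H ((oneForm H).rTensor H (star ξ.1 * η.1))

end Vergnioux

end

/-! Everything rests on ψ being the Haar functional. The map T(a ⊗ b) = Δ(a)(1 ⊗ b) is bijective and
conjugates left multiplication by x ⊗ 1 into left multiplication by Δ(x). Since ψ is the trace of
left multiplication, (ψ ⊗ ψ)Δ(x) = ψ(x)ψ(1) (`oneFormTensor_comul`), and faithfulness upgrades this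
to invariance on both sides (`sliceRight_comul`, `sliceLeft_comul`). Strong invariance and
traciality then make the antipode S an involutive, *-preserving antiautomorphism that fixes ψ.

Consequently x ↦ x ⋆ · is injective, turns products into Schur products
(`schurProduct_convolution`), x* into the conjugate operator and S(x)* into the adjoint
(`adj_convolution`). For a central projection P, the operator P ⋆ · is therefore a quantum adjacency
matrix, undirected exactly when S(P) = P. On the side of representations, S maps the projection of a
set to the projection of the conjugate set (`conjSet_supp`), so undirected means symmetric
(`isSymmetric_iff`). That sets and central projections correspond at all comes from Schur's lemma
and from the fact that irreducible representations separate points.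

For the isomorphism, ⟨Φ(a ⊗ b) | Φ(c ⊗ d)⟩ = b* (ψ ⊗ id)((P ⊗ 1)Δ(a* c)) d, which is b* A(a* c) d
because S(P) = P (`inner_edgeMap`). So Φ, onto because T is, kills exactly the radical of the edge
form. The axioms are checked on K and pulled back to E_A. Both families of graphs are parametrised
by the symmetric generating sets, and the bijection of part (2) composes the two parametrisations.
-/

noncomputable section

universe u

open FiniteQuantumGroup

/-! ## The Hilbert space structure on `H ⊗ H` -/

section TensorForm

variable (H : Type u) [CStarAlgebra H]

/-- The functional `ψ ⊗ ψ`. -/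
def oneFormTensor : H ⊗[ℂ] H →ₗ[ℂ] ℂ :=
  LinearMap.mul' ℂ ℂ ∘ₗ TensorProduct.map (oneForm H) (oneForm H)

variable {H}

@[simp]
theorem oneFormTensor_tmul (a b : H) :
    oneFormTensor H (a ⊗ₜ b) = oneForm H a * oneForm H b := rfl

theorem oneForm_lid_rTensor (t : H ⊗[ℂ] H) :
    oneForm H (TensorProduct.lid ℂ H ((oneForm H).rTensor H t)) = oneFormTensor H t := by
  induction t with
  | zero => simp
  | tmul a b => simp
  | add x y hx hy => simp only [map_add, hx, hy]

variable (H) in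
/-- The slice map `id ⊗ ψ`. -/
def sliceRight : H ⊗[ℂ] H →ₗ[ℂ] H := (TensorProduct.rid ℂ H).toLinearMap ∘ₗ (oneForm H).lTensor H

variable (H) in
/-- The slice map `ψ ⊗ id`. -/
def sliceLeft : H ⊗[ℂ] H →ₗ[ℂ] H := (TensorProduct.lid ℂ H).toLinearMap ∘ₗ (oneForm H).rTensor H

@[simp]
theorem sliceRight_tmul (a b : H) : sliceRight H (a ⊗ₜ b) = oneForm H b • a := by
  simp [sliceRight]

@[simp]
theorem sliceLeft_tmul (a b : H) : sliceLeft H (a ⊗ₜ b) = oneForm H a • b := by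
  simp [sliceLeft]

theorem oneForm_sliceRight (t : H ⊗[ℂ] H) : oneForm H (sliceRight H t) = oneFormTensor H t := by
  induction t with
  | zero => simp
  | tmul a b => simp [mul_comm]
  | add x y hx hy => simp only [map_add, hx, hy]

theorem oneForm_sliceLeft (t : H ⊗[ℂ] H) : oneForm H (sliceLeft H t) = oneFormTensor H t :=
  oneForm_lid_rTensor t

theorem sliceRight_mul (x : H) (t : H ⊗[ℂ] H) :
    sliceRight H ((x ⊗ₜ 1) * t) = x * sliceRight H t := by
  induction t with
  | zero => simp
  | tmul a b => simp
  | add y z hy hz => simp only [mul_add, map_add, hy, hz]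

theorem sliceRight_mul' (x : H) (t : H ⊗[ℂ] H) :
    sliceRight H (t * (x ⊗ₜ 1)) = sliceRight H t * x := by
  induction t with
  | zero => simp
  | tmul a b => simp
  | add y z hy hz => simp only [add_mul, map_add, hy, hz]

theorem sliceLeft_mul (x : H) (t : H ⊗[ℂ] H) :
    sliceLeft H ((1 ⊗ₜ x) * t) = x * sliceLeft H t := by
  induction t with
  | zero => simp
  | tmul a b => simp
  | add y z hy hz => simp only [mul_add, map_add, hy, hz]

theorem sliceLeft_mul' (x : H) (t : H ⊗[ℂ] H) :
    sliceLeft H (t * (1 ⊗ₜ x)) = sliceLeft H t * x := by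
  induction t with
  | zero => simp
  | tmul a b => simp
  | add y z hy hz => simp only [add_mul, map_add, hy, hz]

/-- Traciality of ψ in the first leg. -/
theorem sliceLeft_tmul_one_comm (x : H) (t : H ⊗[ℂ] H) :
    sliceLeft H ((x ⊗ₜ 1) * t) = sliceLeft H (t * (x ⊗ₜ 1)) := by
  induction t with
  | zero => simp
  | tmul a b => simp [oneForm_mul_comm x a]
  | add y z hy hz => simp only [add_mul, mul_add, map_add, hy, hz]

variable [FiniteDimensional ℂ H]

theorem inner_map_toL2 (s t : H ⊗[ℂ] H) :
    inner ℂ (TensorProduct.map (toL2 H).toLinearMap (toL2 H).toLinearMap s)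
      (TensorProduct.map (toL2 H).toLinearMap (toL2 H).toLinearMap t) =
        oneFormTensor H (star s * t) := by
  induction s with
  | zero => simp
  | add x y hx hy => simp only [map_add, inner_add_left, hx, hy, star_add, add_mul]
  | tmul a b =>
    induction t with
    | zero => simp
    | add x y hx hy => simp only [map_add, inner_add_right, hx, hy, mul_add]
    | tmul c d => simp [TensorProduct.inner_tmul, L2.inner_def]

theorem oneFormTensor_faithful (t : H ⊗[ℂ] H) (h : oneFormTensor H (star t * t) = 0) : t = 0 := by
  rw [← inner_map_toL2] at h
  exact (TensorProduct.congr (toL2 H) (toL2 H)).injective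
    ((inner_self_eq_zero.1 h).trans (map_zero _).symm)

/-- Faithfulness makes h ↦ ψ(h ·) injective into the dual, hence onto by equality of dimensions. It
is applied to the counit, whose density turns identities about ψ into identities about the antipode.
-/
theorem exists_density (f : H →ₗ[ℂ] ℂ) : ∃ h : H, ∀ a, oneForm H (h * a) = f a := by
  let D : H →ₗ[ℂ] Module.Dual ℂ H := (LinearMap.compr₂ (LinearMap.mul ℂ H) (oneForm H))
  have hD : Function.Injective D := by
    rw [← LinearMap.ker_eq_bot, LinearMap.ker_eq_bot']
    intro x hx
    have h := congrArg (fun f => f (star x)) hx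
    apply oneForm_faithful
    rw [oneForm_mul_comm]
    exact h
  obtain ⟨h, hh⟩ :=
    (LinearMap.injective_iff_surjective_of_finrank_eq_finrank
      (Subspace.dual_finrank_eq (K := ℂ) (V := H)).symm).1 hD f
  exact ⟨h, fun a => congrArg (fun f => f a) hh⟩

theorem eq_of_oneForm_mul_eq {x y : H} (h : ∀ a, oneForm H (x * a) = oneForm H (y * a)) :
    x = y := by
  rw [← sub_eq_zero]
  apply oneForm_faithful
  rw [oneForm_mul_comm, sub_mul, map_sub, h, sub_self]

variable (H) in
theorem oneForm_one_ne_zero [Nontrivial H] : oneForm H 1 ≠ 0 := by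
  intro h
  exact one_ne_zero (oneForm_faithful (1 : H) (by simpa using h))

theorem sliceRight_star (t : H ⊗[ℂ] H) : sliceRight H (star t) = star (sliceRight H t) := by
  induction t with
  | zero => simp
  | tmul a b => simp [oneForm_star]
  | add x y hx hy => simp only [star_add, map_add, hx, hy]

theorem sliceLeft_star (t : H ⊗[ℂ] H) : sliceLeft H (star t) = star (sliceLeft H t) := by
  induction t with
  | zero => simp
  | tmul a b => simp [oneForm_star]
  | add x y hx hy => simp only [star_add, map_add, hx, hy]

end TensorForm

/-! ## The Haar property of `ψ` -/

section Haar

variable {H : Type u} [CStarAlgebra H] [FiniteQuantumGroup H]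

open Coalgebra

theorem sum_left_mul_antipode {ι : Type*} {a : H} (r : Repr ℂ a ι) :
    ∑ i ∈ r.index, r.left i * antipode (r.right i) = counit (R := ℂ) a • 1 := by
  have h := congr($(mul_antipode_lTensor_comul (H := H)) a)
  rw [LinearMap.comp_apply, LinearMap.comp_apply, ← r.eq] at h
  simpa [Algebra.algebraMap_eq_smul_one] using h

theorem sum_antipode_mul_right {ι : Type*} {a : H} (r : Repr ℂ a ι) :
    ∑ i ∈ r.index, antipode (r.left i) * r.right i = counit (R := ℂ) a • 1 := by
  have h := congr($(mul_antipode_rTensor_comul (H := H)) a)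
  rw [LinearMap.comp_apply, LinearMap.comp_apply, ← r.eq] at h
  simpa [Algebra.algebraMap_eq_smul_one] using h

theorem antipode_mul (a b : H) : antipode (a * b) = antipode b * antipode a :=
  letI := hopfAlgebra H
  HopfAlgebra.antipode_mul_antidistrib (R := ℂ) a b

theorem antipode_one : antipode (1 : H) = 1 :=
  letI := hopfAlgebra H
  HopfAlgebra.antipode_one (R := ℂ) (A := H)

/-- Coassociativity in Sweedler form. Each later use encodes an expression in a₁, a₂, a₃ as a linear
map `G` and regroups the triple sum. -/
theorem sum_coassoc {M : Type*} [AddCommMonoid M] [Module ℂ M]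
    (G : H ⊗[ℂ] (H ⊗[ℂ] H) →ₗ[ℂ] M) (a : H) :
    ∑ i ∈ (ℛ ℂ a).index, ∑ j ∈ (ℛ ℂ ((ℛ ℂ a).left i)).index,
      G ((ℛ ℂ ((ℛ ℂ a).left i)).left j ⊗ₜ ((ℛ ℂ ((ℛ ℂ a).left i)).right j ⊗ₜ (ℛ ℂ a).right i)) =
    ∑ i ∈ (ℛ ℂ a).index, ∑ j ∈ (ℛ ℂ ((ℛ ℂ a).right i)).index,
      G ((ℛ ℂ a).left i ⊗ₜ
        ((ℛ ℂ ((ℛ ℂ a).right i)).left j ⊗ₜ (ℛ ℂ ((ℛ ℂ a).right i)).right j)) := by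
  simpa only [map_sum] using congrArg G
    (sum_tmul_tmul_eq (ℛ ℂ a) (fun i => ℛ ℂ ((ℛ ℂ a).left i)) (fun i => ℛ ℂ ((ℛ ℂ a).right i)))

theorem sum_counit_right_smul {ι : Type*} {a : H} (r : Repr ℂ a ι) :
    ∑ i ∈ r.index, counit (R := ℂ) (r.right i) • r.left i = a := by
  have h := congrArg (TensorProduct.rid ℂ H) (sum_tmul_counit_eq (R := ℂ) r)
  simpa only [map_sum, TensorProduct.rid_tmul, one_smul] using h

variable (H) in
/-- The map `a ⊗ b ↦ Δ(a)(1 ⊗ b)`. -/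
def comulMul : H ⊗[ℂ] H →ₗ[ℂ] H ⊗[ℂ] H :=
  (LinearMap.mul' ℂ H).lTensor H ∘ₗ (TensorProduct.assoc ℂ H H H).toLinearMap ∘ₗ
    (comul (R := ℂ)).rTensor H

theorem comulMul_tmul (a b : H) : comulMul H (a ⊗ₜ b) = comul (R := ℂ) a * (1 ⊗ₜ b) := by
  simp only [comulMul, LinearMap.comp_apply, LinearMap.rTensor_tmul]
  rw [← (ℛ ℂ a).eq]
  simp [TensorProduct.sum_tmul, Finset.sum_mul]

/-- The preimage of a ⊗ b is ∑ a₁ ⊗ S(a₂)b, because ∑ a₁ ⊗ a₂S(a₃)b = a ⊗ b. -/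
theorem comulMul_surjective : Function.Surjective (comulMul H) := by
  rw [← LinearMap.range_eq_top, eq_top_iff, ← TensorProduct.span_tmul_eq_top, Submodule.span_le]
  rintro _ ⟨a, b, rfl⟩
  refine ⟨∑ i ∈ (ℛ ℂ a).index, (ℛ ℂ a).left i ⊗ₜ (antipode ((ℛ ℂ a).right i) * b), ?_⟩
  let G : H ⊗[ℂ] (H ⊗[ℂ] H) →ₗ[ℂ] H ⊗[ℂ] H :=
    (LinearMap.mulRight ℂ b ∘ₗ LinearMap.mul' ℂ H ∘ₗ antipode.lTensor H).lTensor H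
  have hG : ∀ p q r : H, G (p ⊗ₜ (q ⊗ₜ r)) = p ⊗ₜ (q * antipode r * b) := fun p q r => rfl
  have h := sum_coassoc G a
  simp only [hG] at h
  rw [map_sum]
  calc _ = _ := by
        refine Finset.sum_congr rfl fun i _ => ?_
        rw [comulMul_tmul, ← (ℛ ℂ ((ℛ ℂ a).left i)).eq, Finset.sum_mul]
        simp only [Algebra.TensorProduct.tmul_mul_tmul, mul_one, ← mul_assoc]
    _ = _ := h
    _ = _ := by
        simp only [← TensorProduct.tmul_sum, ← Finset.sum_mul, sum_left_mul_antipode]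
        simp only [smul_mul_assoc, one_mul, TensorProduct.tmul_smul]
        simp only [TensorProduct.smul_tmul', ← TensorProduct.sum_tmul, sum_counit_right_smul]

theorem trace_mulLeft_tensor (t : H ⊗[ℂ] H) :
    LinearMap.trace ℂ _ (LinearMap.mulLeft ℂ t) = oneFormTensor H t := by
  induction t with
  | zero => simp
  | add x y hx hy =>
    have : LinearMap.mulLeft ℂ (x + y) = LinearMap.mulLeft ℂ x + LinearMap.mulLeft ℂ y := by
      ext; simp [add_mul]
    rw [this, map_add, hx, hy, map_add]
  | tmul a b =>
    have : LinearMap.mulLeft ℂ (a ⊗ₜ[ℂ] b) =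
        TensorProduct.map (LinearMap.mulLeft ℂ a) (LinearMap.mulLeft ℂ b) := by
      ext; simp
    rw [this, LinearMap.trace_tensorProduct']
    rfl

/-- Left multiplications by Δ(x) and by x ⊗ 1 are conjugate under the bijection `comulMul`, so their
traces on H ⊗ H agree. -/
theorem oneFormTensor_comul (x : H) :
    oneFormTensor H (comul x) = oneForm H x * oneForm H 1 := by
  let T : H ⊗[ℂ] H ≃ₗ[ℂ] H ⊗[ℂ] H := LinearEquiv.ofBijective (comulMul H)
    ⟨LinearMap.injective_iff_surjective.2 comulMul_surjective, comulMul_surjective⟩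
  have h : LinearMap.mulLeft ℂ (comul (R := ℂ) x) = T.conj (LinearMap.mulLeft ℂ (x ⊗ₜ 1)) := by
    rw [LinearEquiv.conj_apply, LinearEquiv.eq_comp_toLinearMap_symm]
    ext a b
    change comul (R := ℂ) x * comulMul H (a ⊗ₜ b) = comulMul H ((x ⊗ₜ 1) * (a ⊗ₜ b))
    rw [Algebra.TensorProduct.tmul_mul_tmul, comulMul_tmul, comulMul_tmul, comul_mul, one_mul,
      mul_assoc]
  rw [← trace_mulLeft_tensor, h, LinearMap.trace_conj', trace_mulLeft_tensor, oneFormTensor_tmul]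

instance : Nontrivial H := ⟨1, 0, fun h => one_ne_zero (α := ℂ) (by
  rw [← FiniteQuantumGroup.counit_one (H := H), h, map_zero])⟩


/-- Put E = (id ⊗ ψ)Δ. By coassociativity E² = (id ⊗ (ψ ⊗ ψ)Δ)Δ, and `oneFormTensor_comul` reduces
this to ψ(1)E. -/
theorem sliceRight_comul_comul (a : H) :
    sliceRight H (comul (R := ℂ) (sliceRight H (comul (R := ℂ) a))) =
      oneForm H 1 • sliceRight H (comul (R := ℂ) a) := by
  let G : H ⊗[ℂ] (H ⊗[ℂ] H) →ₗ[ℂ] H :=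
    (TensorProduct.rid ℂ H).toLinearMap ∘ₗ (oneFormTensor H).lTensor H
  have hG : ∀ p (t : H ⊗[ℂ] H), G (p ⊗ₜ t) = oneFormTensor H t • p := fun p t => by simp [G]
  have hG' : ∀ p q r, G (p ⊗ₜ (q ⊗ₜ r)) = oneForm H r • sliceRight H (p ⊗ₜ q) :=
    fun p q r => by simp [G, smul_smul, mul_comm]
  have h := sum_coassoc G a
  rw [Finset.sum_congr rfl fun i _ => Finset.sum_congr rfl fun j _ => hG' _ _ _] at h
  simp only [hG, ← Finset.sum_smul, ← Finset.smul_sum, ← map_sum, Repr.eq,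
    oneFormTensor_comul] at h
  rw [← (ℛ ℂ a).eq]
  simpa [mul_smul, Finset.smul_sum, smul_comm (oneForm H 1)] using h

theorem sliceLeft_comul_comul (a : H) :
    sliceLeft H (comul (R := ℂ) (sliceLeft H (comul (R := ℂ) a))) =
      oneForm H 1 • sliceLeft H (comul (R := ℂ) a) := by
  let G : H ⊗[ℂ] (H ⊗[ℂ] H) →ₗ[ℂ] H :=
    (TensorProduct.lid ℂ H).toLinearMap ∘ₗ TensorProduct.map (oneForm H) (sliceLeft H)
  have hG : ∀ p (t : H ⊗[ℂ] H), G (p ⊗ₜ t) = oneForm H p • sliceLeft H t := fun p t => by simp [G]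
  have hG' : ∀ p q r, G (p ⊗ₜ (q ⊗ₜ r)) = oneFormTensor H (p ⊗ₜ q) • r :=
    fun p q r => by simp [G, smul_smul, mul_comm]
  have h := sum_coassoc G a
  rw [Finset.sum_congr rfl fun i _ => Finset.sum_congr rfl fun j _ => hG' _ _ _] at h
  simp only [hG, ← Finset.sum_smul, ← Finset.smul_sum, ← map_sum, Repr.eq,
    oneFormTensor_comul] at h
  rw [← (ℛ ℂ a).eq]
  simpa [mul_smul, Finset.smul_sum, smul_comm (oneForm H 1)] using h.symm

variable (H) in
theorem star_oneForm_one : star (oneForm H 1) = oneForm H 1 := by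
  rw [← starRingEnd_apply, ← oneForm_star, star_one]

/-- Once b is known to be a scalar, ψ(b) determines which one, since ψ(1) ≠ 0. -/
theorem oneForm_smul_eq (a : H) {b : H} (hb : oneForm H b = oneForm H a * oneForm H 1)
    (h : counit (R := ℂ) b • (1 : H) = b) : b = oneForm H a • 1 := by
  have h1 : counit (R := ℂ) b = oneForm H a := by
    apply mul_right_cancel₀ (oneForm_one_ne_zero H)
    rw [← hb, ← smul_eq_mul, ← map_smul, h]
  rw [← h1, h]

/-- `(id ⊗ ψ) Δ(a) = ψ(a) 1`. -/
theorem sliceRight_comul (a : H) :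
    sliceRight H (comul (R := ℂ) a) = oneForm H a • 1 := by
  set b := sliceRight H (comul (R := ℂ) a) with hb
  have h1 : sliceRight H (comul (R := ℂ) b) = oneForm H 1 • b := sliceRight_comul_comul a
  -- The squared ψ ⊗ ψ norm expands into four terms, each equal to ψ(1)ψ(b* b) by `h1` and
  -- `oneFormTensor_comul`, with signs +, −, −, +.
  have h2 : comul (R := ℂ) b - b ⊗ₜ 1 = 0 := by
    apply oneFormTensor_faithful
    rw [star_sub, sub_mul, mul_sub, mul_sub, ← FiniteQuantumGroup.comul_star,
      ← FiniteQuantumGroup.comul_mul, TensorProduct.star_tmul, star_one,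
      Algebra.TensorProduct.tmul_mul_tmul, map_sub, map_sub,
      map_sub, ← oneForm_sliceRight (comul (R := ℂ) (star b) * _), sliceRight_mul',
      ← oneForm_sliceRight (_ * comul (R := ℂ) b), sliceRight_mul, FiniteQuantumGroup.comul_star,
      sliceRight_star, h1, oneFormTensor_comul, star_smul, star_oneForm_one]
    simp [mul_comm]
  refine oneForm_smul_eq a (by rw [hb, oneForm_sliceRight, oneFormTensor_comul]) ?_
  -- The counit on the first leg turns Δ(b) = b ⊗ 1 into b = ε(b)1.
  have h3 := congrArg (fun t => TensorProduct.lid ℂ H (counit.rTensor H t)) (sub_eq_zero.1 h2)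
  simpa using h3.symm

/-- `(ψ ⊗ id) Δ(a) = ψ(a) 1`. -/
theorem sliceLeft_comul (a : H) :
    sliceLeft H (comul (R := ℂ) a) = oneForm H a • 1 := by
  set b := sliceLeft H (comul (R := ℂ) a) with hb
  have h1 : sliceLeft H (comul (R := ℂ) b) = oneForm H 1 • b := sliceLeft_comul_comul a
  have h2 : comul (R := ℂ) b - 1 ⊗ₜ b = 0 := by
    apply oneFormTensor_faithful
    rw [star_sub, sub_mul, mul_sub, mul_sub, ← FiniteQuantumGroup.comul_star,
      ← FiniteQuantumGroup.comul_mul, TensorProduct.star_tmul, star_one,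
      Algebra.TensorProduct.tmul_mul_tmul, map_sub, map_sub,
      map_sub, ← oneForm_sliceLeft (comul (R := ℂ) (star b) * _), sliceLeft_mul',
      ← oneForm_sliceLeft (_ * comul (R := ℂ) b), sliceLeft_mul, FiniteQuantumGroup.comul_star,
      sliceLeft_star, h1, oneFormTensor_comul, star_smul, star_oneForm_one]
    simp [mul_comm]
  refine oneForm_smul_eq a (by rw [hb, oneForm_sliceLeft, oneFormTensor_comul]) ?_
  have h3 := congrArg (fun t => TensorProduct.rid ℂ H (counit.lTensor H t)) (sub_eq_zero.1 h2)
  simpa using h3.symm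

/-- Invariance gives ψ(a₂b)1 = ∑ a₂b₁ψ(a₃b₂). Multiplying by S(a₁) on the left collapses S(a₁)a₂ to
a counit and leaves ∑ b₁ψ(ab₂). -/
theorem sum_smul_antipode_left (a b : H) :
    ∑ i ∈ (ℛ ℂ a).index, oneForm H ((ℛ ℂ a).right i * b) • antipode ((ℛ ℂ a).left i) =
      ∑ k ∈ (ℛ ℂ b).index, oneForm H (a * (ℛ ℂ b).right k) • (ℛ ℂ b).left k := by
  let G (c d : H) : H ⊗[ℂ] (H ⊗[ℂ] H) →ₗ[ℂ] H :=
    LinearMap.mul' ℂ H ∘ₗ TensorProduct.map antipode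
      ((TensorProduct.rid ℂ H).toLinearMap ∘ₗ TensorProduct.map (LinearMap.mulRight ℂ c)
        (oneForm H ∘ₗ LinearMap.mulRight ℂ d))
  have hG : ∀ c d p q r, G c d (p ⊗ₜ (q ⊗ₜ r)) = oneForm H (r * d) • (antipode p * q * c) :=
    fun c d p q r => by simp [G, mul_assoc]
  have h1 : ∀ i, oneForm H ((ℛ ℂ a).right i * b) • antipode ((ℛ ℂ a).left i) =
      ∑ k ∈ (ℛ ℂ b).index, ∑ j ∈ (ℛ ℂ ((ℛ ℂ a).right i)).index,
        G ((ℛ ℂ b).left k) ((ℛ ℂ b).right k) ((ℛ ℂ a).left i ⊗ₜ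
          ((ℛ ℂ ((ℛ ℂ a).right i)).left j ⊗ₜ (ℛ ℂ ((ℛ ℂ a).right i)).right j)) := by
    intro i
    have h2 := congrArg (antipode ((ℛ ℂ a).left i) * ·)
      (sliceRight_comul ((ℛ ℂ a).right i * b))
    rw [FiniteQuantumGroup.comul_mul, ← (ℛ ℂ b).eq, ← (ℛ ℂ ((ℛ ℂ a).right i)).eq,
      Finset.sum_mul_sum, Finset.sum_comm] at h2
    simp only [Algebra.TensorProduct.tmul_mul_tmul, map_sum, sliceRight_tmul, mul_smul_comm,
      mul_one, Finset.mul_sum] at h2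
    rw [← h2]
    simp only [hG, mul_assoc]
  rw [Finset.sum_congr rfl fun i _ => h1 i, Finset.sum_comm]
  refine Finset.sum_congr rfl fun k _ => ?_
  rw [← sum_coassoc]
  simp only [hG, ← Finset.smul_sum, ← Finset.sum_mul, sum_antipode_mul_right]
  simp only [smul_mul_assoc, one_mul, smul_smul, ← Finset.sum_smul]
  congr 1
  have h := congrArg (fun x => oneForm H (x * (ℛ ℂ b).right k)) (sum_counit_smul (ℛ ℂ a))
  simpa [Finset.sum_mul, mul_comm] using h

/-- The mirror computation: (ψ ⊗ id)Δ(ba₁) is multiplied on the right by S(a₂), and a factor a₂S(a₃)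
collapses. -/
theorem sum_smul_antipode_right (a b : H) :
    ∑ i ∈ (ℛ ℂ a).index, oneForm H (b * (ℛ ℂ a).left i) • antipode ((ℛ ℂ a).right i) =
      ∑ k ∈ (ℛ ℂ b).index, oneForm H ((ℛ ℂ b).left k * a) • (ℛ ℂ b).right k := by
  let G (c d : H) : H ⊗[ℂ] (H ⊗[ℂ] H) →ₗ[ℂ] H :=
    (TensorProduct.lid ℂ H).toLinearMap ∘ₗ
      TensorProduct.map (oneForm H ∘ₗ LinearMap.mulLeft ℂ c)
        (LinearMap.mulLeft ℂ d ∘ₗ LinearMap.mul' ℂ H ∘ₗ antipode.lTensor H)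
  have hG : ∀ c d p q r, G c d (p ⊗ₜ (q ⊗ₜ r)) = oneForm H (c * p) • (d * (q * antipode r)) :=
    fun c d p q r => by simp [G]
  have h1 : ∀ i, oneForm H (b * (ℛ ℂ a).left i) • antipode ((ℛ ℂ a).right i) =
      ∑ k ∈ (ℛ ℂ b).index, ∑ j ∈ (ℛ ℂ ((ℛ ℂ a).left i)).index,
        G ((ℛ ℂ b).left k) ((ℛ ℂ b).right k) ((ℛ ℂ ((ℛ ℂ a).left i)).left j ⊗ₜ
          ((ℛ ℂ ((ℛ ℂ a).left i)).right j ⊗ₜ (ℛ ℂ a).right i)) := by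
    intro i
    have h2 := congrArg (· * antipode ((ℛ ℂ a).right i))
      (sliceLeft_comul (b * (ℛ ℂ a).left i))
    rw [FiniteQuantumGroup.comul_mul, ← (ℛ ℂ b).eq, ← (ℛ ℂ ((ℛ ℂ a).left i)).eq,
      Finset.sum_mul_sum] at h2
    simp only [Algebra.TensorProduct.tmul_mul_tmul, map_sum, sliceLeft_tmul, smul_mul_assoc,
      one_mul, Finset.sum_mul] at h2
    rw [← h2]
    simp only [hG, mul_assoc]
  rw [Finset.sum_congr rfl fun i _ => h1 i, Finset.sum_comm]
  refine Finset.sum_congr rfl fun k _ => ?_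
  rw [sum_coassoc]
  simp only [hG, ← Finset.smul_sum, ← Finset.mul_sum, sum_left_mul_antipode]
  simp only [mul_smul_comm, mul_one, smul_smul, ← Finset.sum_smul]
  congr 1
  have h := congrArg (fun x => oneForm H ((ℛ ℂ b).left k * x)) (sum_counit_right_smul (ℛ ℂ a))
  simpa [Finset.mul_sum, mul_comm] using h

/-! ## Properties of the antipode -/

/-- With h the density of the counit, strong invariance yields S(a) = ∑ ψ(ah₂)h₁ and also a = ∑
ψ(h₂a)S(h₁). Traciality identifies the second sum with S applied to the first. -/
theorem antipode_antipode (a : H) : antipode (antipode a) = a := by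
  obtain ⟨h, hh⟩ := exists_density (counit (R := ℂ) (A := H))
  have h1 := congrArg antipode (sum_smul_antipode_left a h)
  have h2 := sum_smul_antipode_left h a
  simp only [map_sum, map_smul] at h1
  simp only [oneForm_mul_comm _ a, oneForm_mul_comm _ h, hh] at h1 h2
  rw [← h1, sum_counit_right_smul] at h2
  nth_rw 2 [← h2]
  nth_rw 1 [← sum_counit_right_smul (ℛ ℂ a)]
  simp only [map_sum, map_smul]

/-- Strong right invariance of `ψ`. -/
theorem antipode_sliceLeft (a b : H) :
    antipode (sliceLeft H ((b ⊗ₜ 1) * comul (R := ℂ) a)) =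
      sliceLeft H (comul (R := ℂ) b * (a ⊗ₜ 1)) := by
  have h := sum_smul_antipode_right a b
  rw [← (ℛ ℂ a).eq, ← (ℛ ℂ b).eq]
  simpa [Finset.mul_sum, Finset.sum_mul] using h

/-- Strong left invariance of `ψ`. -/
theorem antipode_sliceRight (a b : H) :
    antipode (sliceRight H (comul (R := ℂ) a * (1 ⊗ₜ b))) =
      sliceRight H ((1 ⊗ₜ a) * comul (R := ℂ) b) := by
  have h := sum_smul_antipode_left a b
  rw [← (ℛ ℂ a).eq, ← (ℛ ℂ b).eq]
  simpa [Finset.mul_sum, Finset.sum_mul] using h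

theorem sliceLeft_comul_mul (a b : H) :
    sliceLeft H ((b ⊗ₜ 1) * comul (R := ℂ) a) =
      antipode (sliceLeft H (comul (R := ℂ) b * (a ⊗ₜ 1))) := by
  rw [← antipode_sliceLeft, antipode_antipode]

/-- This is strong right invariance for the density of the counit. It expresses S through ψ and Δ,
so that the involution and ψ can be applied to it. -/
theorem antipode_eq_sliceLeft {h : H} (hh : ∀ a, oneForm H (h * a) = counit (R := ℂ) a) (a : H) :
    antipode a = sliceLeft H (comul (R := ℂ) h * (a ⊗ₜ 1)) := by
  rw [← antipode_sliceLeft]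
  congr 1
  rw [← (ℛ ℂ a).eq]
  simp [Finset.mul_sum, hh, sum_counit_smul]

theorem antipode_star (a : H) : antipode (star a) = star (antipode a) := by
  obtain ⟨h, hh⟩ := exists_density (counit (R := ℂ) (A := H))
  -- The adjoint of h is again a density of the counit, since ψ and ε are hermitian and ψ is
  -- tracial.
  have hs : ∀ a, oneForm H (star h * a) = counit (R := ℂ) a := by
    intro a
    rw [oneForm_mul_comm, ← star_star (_ * _), oneForm_star, star_mul, star_star, hh,
      FiniteQuantumGroup.counit_star, starRingEnd_apply, star_star]
  rw [antipode_eq_sliceLeft hh a, antipode_eq_sliceLeft hs, ← sliceLeft_star, star_mul,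
    FiniteQuantumGroup.comul_star, TensorProduct.star_tmul, star_one, sliceLeft_tmul_one_comm]

theorem oneForm_antipode (a : H) : oneForm H (antipode a) = oneForm H a := by
  obtain ⟨h, hh⟩ := exists_density (counit (R := ℂ) (A := H))
  have h1 : oneForm H h = 1 := by
    rw [← mul_one h, hh, FiniteQuantumGroup.counit_one]
  rw [antipode_eq_sliceLeft hh, oneForm_sliceLeft, ← oneForm_sliceRight, sliceRight_mul',
    sliceRight_comul, h1, one_smul, one_mul]

end Haar

/-! ## Convolution operators -/

section Convolution

variable {H : Type u} [CStarAlgebra H] [FiniteQuantumGroup H]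

open Coalgebra

theorem adj_eq_iff {A A' : H →ₗ[ℂ] H} :
    adj A = A' ↔ ∀ a b, oneForm H (star (A a) * b) = oneForm H (star a * A' b) := by
  have h : ∀ a b, oneForm H (star a * adj A b) = oneForm H (star (A a) * b) := by
    intro a b
    rw [← L2.inner_def, ← L2.inner_def]
    exact LinearMap.adjoint_inner_right _ _ _
  constructor
  · rintro rfl a b
    exact (h a b).symm
  · intro h'
    ext b
    apply eq_of_oneForm_mul_eq
    intro a
    rw [oneForm_mul_comm, oneForm_mul_comm _ a, ← star_star a, h, h']

theorem leftConv_density (u a : H) :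
    leftConv (density u) a = sliceLeft H ((u ⊗ₜ 1) * comul (R := ℂ) a) := by
  simp only [leftConv, LinearMap.comp_apply, ← (ℛ ℂ a).eq, Finset.mul_sum, map_sum]
  simp [density]

/-- Composing the operator with the counit recovers the functional: ε ∘ L_ω = ω. -/
theorem leftConv_injective : Function.Injective (leftConv (H := H)) := by
  intro ω ν h
  have h1 : ∀ (ω : H →ₗ[ℂ] ℂ) (a : H), counit (R := ℂ) (leftConv ω a) = ω a := by
    intro ω a
    have h2 := congrArg ω (sum_counit_right_smul (ℛ ℂ a))
    simp only [leftConv, LinearMap.comp_apply, ← (ℛ ℂ a).eq, map_sum] at h2 ⊢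
    simpa [mul_comm] using h2
  ext a
  rw [← h1, h, h1]

theorem convolution_injective : Function.Injective (convolution (H := H)) := by
  intro x y h
  have h1 : antipode x = antipode y :=
    eq_of_oneForm_mul_eq fun a => congrArg (fun f => f a) (leftConv_injective h)
  rw [← antipode_antipode x, h1, antipode_antipode]

theorem star_convolution (x a : H) :
    star (convolution x (star a)) = convolution (star x) a := by
  rw [convolution, leftConv_density, ← sliceLeft_star, star_mul, FiniteQuantumGroup.comul_star,
    star_star, TensorProduct.star_tmul, star_one, ← sliceLeft_tmul_one_comm, ← antipode_star,
    convolution, leftConv_density]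

theorem oneForm_antipode_mul (x y : H) :
    oneForm H (antipode x * y) = oneForm H (antipode y * x) := by
  rw [← oneForm_antipode, antipode_mul, antipode_antipode]

/-- With u = S(x)* and c = a*, the pairing is (ψ ⊗ ψ)(Δ(c)(u ⊗ b)). Strong left invariance moves Δ
from c to b at the cost of an antipode, which lands on u. -/
theorem adj_convolution (x : H) : adj (convolution x) = convolution (star (antipode x)) := by
  rw [adj_eq_iff]
  intro a b
  rw [convolution, convolution, leftConv_density, leftConv_density, ← sliceLeft_star, star_mul,
    ← FiniteQuantumGroup.comul_star, TensorProduct.star_tmul, star_one]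
  set u := star (antipode x)
  set c := star a
  calc oneForm H (sliceLeft H (comul (R := ℂ) c * (u ⊗ₜ 1)) * b)
      = oneForm H (sliceRight H (comul (R := ℂ) c * (1 ⊗ₜ b)) * u) := by
        rw [← sliceLeft_mul', ← sliceRight_mul', oneForm_sliceLeft, oneForm_sliceRight,
          mul_assoc, mul_assoc]
        simp
    _ = oneForm H (antipode (sliceRight H ((1 ⊗ₜ c) * comul (R := ℂ) b)) * u) := by
        rw [← antipode_sliceRight, antipode_antipode]
    _ = oneForm H (antipode u * sliceRight H ((1 ⊗ₜ c) * comul (R := ℂ) b)) :=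
        oneForm_antipode_mul _ _
    _ = oneForm H (c * sliceLeft H ((antipode u ⊗ₜ 1) * comul (R := ℂ) b)) := by
        rw [← sliceLeft_mul, ← sliceRight_mul, oneForm_sliceLeft, oneForm_sliceRight,
          ← mul_assoc, ← mul_assoc]
        simp

theorem sum_oneForm_mul_smul_star {ι : Type*} [Fintype ι] (e : OrthonormalBasis ι ℂ (L2 H))
    (x : H) :
    ∑ i, oneForm H (x * (toL2 H).symm (e i)) • star ((toL2 H).symm (e i)) = x := by
  apply star_injective
  apply (toL2 H).injective
  rw [star_sum, map_sum, ← e.sum_repr' (toL2 H (star x))]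
  refine Finset.sum_congr rfl fun i _ => ?_
  have h := L2.inner_def ((toL2 H).symm (e i)) (star x)
  rw [LinearEquiv.apply_symm_apply] at h
  rw [h, star_smul, star_star, ← starRingEnd_apply, ← oneForm_star, star_mul, map_smul,
    LinearEquiv.apply_symm_apply]

/-- Put u = S(x), v = S(y). Strong invariance writes L_u(eᵢ) as ∑ ψ(u₁eᵢ)S(u₂), and contracting the
orthonormal basis in m* leaves ∑ S(u₂)L_v(u₁z). Expanding Δ(u₁z) produces S(u₃)u₂, which collapses
to a counit and gives L_{vu}, where vu = S(xy). -/
theorem schurProduct_convolution (x y : H) :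
    schurProduct (convolution x) (convolution y) = convolution (x * y) := by
  ext z
  rw [convolution, convolution, convolution, antipode_mul]
  set u := antipode x
  set v := antipode y
  set e := stdOrthonormalBasis ℂ (L2 H)
  let G : H ⊗[ℂ] (H ⊗[ℂ] H) →ₗ[ℂ] H :=
    sliceLeft H ∘ₗ LinearMap.mulRight ℂ (comul (R := ℂ) z) ∘ₗ
      TensorProduct.map (LinearMap.mulLeft ℂ v) (LinearMap.mul' ℂ H ∘ₗ
        (TensorProduct.comm ℂ H H).toLinearMap ∘ₗ antipode.lTensor H)
  have hG : ∀ p q r, G (p ⊗ₜ (q ⊗ₜ r)) =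
      sliceLeft H (((v * p) ⊗ₜ (antipode r * q)) * comul (R := ℂ) z) := fun p q r => by
    simp [G]
  have h1 : ∀ i, leftConv (density u) ((toL2 H).symm (e i)) =
      ∑ k ∈ (ℛ ℂ u).index, oneForm H ((ℛ ℂ u).left k * (toL2 H).symm (e i)) •
        antipode ((ℛ ℂ u).right k) := by
    intro i
    rw [leftConv_density, sliceLeft_comul_mul, ← (ℛ ℂ u).eq, Finset.sum_mul, map_sum, map_sum]
    simp
  have h2 : ∀ k, antipode ((ℛ ℂ u).right k) * leftConv (density v) ((ℛ ℂ u).left k * z) =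
      ∑ j ∈ (ℛ ℂ ((ℛ ℂ u).left k)).index, G ((ℛ ℂ ((ℛ ℂ u).left k)).left j ⊗ₜ
        ((ℛ ℂ ((ℛ ℂ u).left k)).right j ⊗ₜ (ℛ ℂ u).right k)) := by
    intro k
    rw [leftConv_density, FiniteQuantumGroup.comul_mul, ← (ℛ ℂ ((ℛ ℂ u).left k)).eq,
      ← sliceLeft_mul, ← mul_assoc, ← mul_assoc, Finset.mul_sum, Finset.sum_mul,
      map_sum]
    simp [hG]
  -- This order of factors relies on S² = id: apply S to ∑ S(a₁)a₂ = ε(a)1.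
  have h3 : ∀ {a : H} (r : Repr ℂ a (H × H)), ∑ i ∈ r.index, antipode (r.right i) * r.left i =
      counit (R := ℂ) a • 1 := by
    intro a r
    have h := congrArg antipode (sum_antipode_mul_right r)
    simpa [antipode_mul, antipode_antipode, antipode_one] using h
  calc schurProduct (leftConv (density u)) (leftConv (density v)) z
      = ∑ i, leftConv (density u) ((toL2 H).symm (e i)) *
          leftConv (density v) (star ((toL2 H).symm (e i)) * z) := by
        simp [schurProduct, mulAdjoint_apply e]
    _ = ∑ k ∈ (ℛ ℂ u).index, antipode ((ℛ ℂ u).right k) *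
          leftConv (density v) ((ℛ ℂ u).left k * z) := by
        simp only [h1, Finset.sum_mul]
        rw [Finset.sum_comm]
        refine Finset.sum_congr rfl fun k _ => ?_
        conv_rhs => rw [← sum_oneForm_mul_smul_star e ((ℛ ℂ u).left k)]
        simp [Finset.sum_mul, Finset.mul_sum]
    _ = leftConv (density (v * u)) z := by
        rw [Finset.sum_congr rfl fun k _ => h2 k, sum_coassoc]
        simp only [hG, ← map_sum, ← Finset.sum_mul, ← TensorProduct.tmul_sum, h3]
        simp only [TensorProduct.tmul_smul, TensorProduct.smul_tmul', ← TensorProduct.sum_tmul,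
          ← mul_smul_comm, ← Finset.mul_sum, sum_counit_right_smul, leftConv_density]

theorem antipode_eq_of_isUndirected {P : CentralProjection H}
    (h : IsUndirected (convolution P.val)) : antipode P.val = P.val := by
  rw [IsUndirected, adj_convolution] at h
  rw [← star_star (antipode P.val), convolution_injective h,
    P.isStarProjection.isSelfAdjoint.star_eq]

theorem isCentralUndirectedCayley_convolution {P : CentralProjection H}
    (h : antipode P.val = P.val) : IsCentralUndirectedCayley (convolution P.val) := by
  have hs : star P.val = P.val := P.isStarProjection.isSelfAdjoint.star_eq
  refine ⟨⟨?_, fun x => ?_⟩, ?_, P, rfl⟩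
  · rw [schurProduct_convolution, P.isStarProjection.isIdempotentElem.eq]
  · rw [star_convolution, hs]
  · rw [IsUndirected, adj_convolution, h, hs]

end Convolution

/-! ## The correspondences -/

section CompletenessAndTransfer

variable {B : Type u} [CStarAlgebra B]

theorem exists_star_mul_self_eq_sum {ι : Type*} (s : Finset ι) (f : ι → B) :
    ∃ b, ∑ i ∈ s, star (f i) * f i = star b * b := by
  let := CStarAlgebra.spectralOrder B
  have := CStarAlgebra.spectralOrderedRing B
  exact CStarAlgebra.nonneg_iff_eq_star_mul_self.1
    (Finset.sum_nonneg fun i _ => star_mul_self_nonneg (f i))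

/-- The identity from ℓ² to B is bounded in finite dimension, and ‖b* b‖ = ‖b‖². -/
theorem exists_norm_star_mul_self_le [FiniteDimensional ℂ B] :
    ∃ C : ℝ, ∀ b : B, ‖star b * b‖ ≤ C * (oneForm B (star b * b)).re := by
  let f : L2 B →L[ℂ] B := LinearMap.toContinuousLinearMap (toL2 B).symm.toLinearMap
  refine ⟨‖f‖ ^ 2, fun b => ?_⟩
  have h1 : ‖b‖ ≤ ‖f‖ * ‖toL2 B b‖ := f.le_opNorm (toL2 B b)
  have h2 : ‖toL2 B b‖ ^ 2 = (oneForm B (star b * b)).re := by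
    rw [@norm_sq_eq_re_inner ℂ, L2.inner_def]; rfl
  rw [← h2, ← mul_pow, CStarRing.norm_star_mul_self, ← sq]
  gcongr

/-- Composing φ with ψ gives a scalar inner product on a finite-dimensional, hence complete, space.
Its squared norm and ‖φ(x, x)‖ bound each other up to constants, so Cauchy sequences and limits
transfer. -/
theorem complete_of_positive_definite [FiniteDimensional ℂ B] {E : Type*} [AddCommGroup E]
    [Module ℂ E] [FiniteDimensional ℂ E] (φ : E → E → B)
    (hadd : ∀ ξ η ζ, φ ξ (η + ζ) = φ ξ η + φ ξ ζ) (hsmul : ∀ (z : ℂ) ξ η, φ ξ (z • η) = z • φ ξ η)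
    (hstar : ∀ ξ η, star (φ ξ η) = φ η ξ) (hpos : ∀ ξ, ∃ b, φ ξ ξ = star b * b)
    (hdef : ∀ ξ, φ ξ ξ = 0 → ξ = 0) (u : ℕ → E)
    (hu : ∀ ε > 0, ∃ N, ∀ m ≥ N, ∀ n ≥ N, ‖φ (u m - u n) (u m - u n)‖ < ε) :
    ∃ ξ, Filter.Tendsto (fun n => ‖φ (u n - ξ) (u n - ξ)‖) Filter.atTop (nhds 0) := by
  let core : InnerProductSpace.Core ℂ E :=
    { inner := fun x y => oneForm B (φ x y)
      conj_inner_symm := fun x y => by rw [← oneForm_star, hstar]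
      re_inner_nonneg := fun x => by
        obtain ⟨b, hb⟩ := hpos x
        rw [hb]
        exact oneForm_nonneg b
      add_left := fun x y z => by
        rw [← hstar, hadd, star_add, hstar, hstar, map_add]
      smul_left := fun x y r => by
        rw [← hstar, hsmul, star_smul, hstar, map_smul, smul_eq_mul, starRingEnd_apply]
      definite := fun x h => by
        obtain ⟨b, hb⟩ := hpos x
        apply hdef
        rw [hb] at h ⊢
        rw [oneForm_faithful b h, mul_zero] }
  let := core.toNormedAddCommGroup
  let := InnerProductSpace.ofCore core.toCore
  have : CompleteSpace E := FiniteDimensional.complete ℂ E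
  have hnorm : ∀ x : E, ‖x‖ ^ 2 = (oneForm B (φ x x)).re := fun x => by
    rw [@norm_sq_eq_re_inner ℂ]; rfl
  obtain ⟨C, hC⟩ := exists_norm_star_mul_self_le (B := B)
  have hle : ∀ x, ‖φ x x‖ ≤ C * ‖x‖ ^ 2 := fun x => by
    rw [hnorm]
    obtain ⟨b, hb⟩ := hpos x
    rw [hb]
    exact hC b
  let f : B →L[ℂ] ℂ := LinearMap.toContinuousLinearMap (oneForm B)
  have hge : ∀ x, ‖x‖ ^ 2 ≤ ‖f‖ * ‖φ x x‖ := fun x => by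
    rw [hnorm]
    exact (Complex.re_le_norm _).trans (f.le_opNorm _)
  have hcauchy : CauchySeq u := by
    rw [Metric.cauchySeq_iff]
    intro ε hε
    -- The summand 1 keeps the denominator positive; ε² appears because `hge` bounds a squared norm.
    obtain ⟨N, hN⟩ := hu (ε ^ 2 / (‖f‖ + 1)) (by positivity)
    refine ⟨N, fun m hm n hn => ?_⟩
    rw [dist_eq_norm]
    refine lt_of_pow_lt_pow_left₀ 2 hε.le ((hge _).trans_lt ?_)
    have h := hN m hm n hn
    rw [lt_div_iff₀ (by positivity)] at h
    nlinarith [norm_nonneg (φ (u m - u n) (u m - u n))]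
  obtain ⟨ξ, hξ⟩ := cauchySeq_tendsto_of_complete hcauchy
  refine ⟨ξ, squeeze_zero (fun n => norm_nonneg _) (fun n => hle _) ?_⟩
  have h := ((tendsto_iff_norm_sub_tendsto_zero.1 hξ).pow 2).const_mul C
  simpa using h

theorem exists_eq_sum_tmul [FiniteDimensional ℂ B] {ι : Type*} [Fintype ι]
    (e : OrthonormalBasis ι ℂ (L2 B)) (ξ : B ⊗[ℂ] B) :
    ∃ b : ι → B, ξ = ∑ i, (toL2 B).symm (e i) ⊗ₜ b i := by
  induction ξ with
  | zero => exact ⟨0, by simp⟩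
  | add x y hx hy =>
    obtain ⟨b, rfl⟩ := hx
    obtain ⟨c, rfl⟩ := hy
    exact ⟨b + c, by simp [TensorProduct.tmul_add, Finset.sum_add_distrib]⟩
  | tmul x y =>
    refine ⟨fun i => inner ℂ (e i) (toL2 B x) • y, ?_⟩
    have h := congrArg (toL2 B).symm (e.sum_repr' (toL2 B x))
    rw [LinearEquiv.symm_apply_apply] at h
    nth_rw 1 [← h]
    simp [TensorProduct.sum_tmul, TensorProduct.smul_tmul]

/-- Every axiom can be tested after applying Φ. Positivity of the edge form thus never needs a
separate proof. -/
theorem IsCorrespondenceIso.isCStarCorrespondence {E F : Type*} [AddCommGroup E] [Module ℂ E]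
    [AddCommGroup F] [Module ℂ F] {D : CorrespondenceData B E} {D' : CorrespondenceData B F}
    {Φ : E ≃ₗ[ℂ] F} (h : IsCorrespondenceIso D D' Φ) (h' : IsCStarCorrespondence D') :
    IsCStarCorrespondence D where
  right_add ξ η b := Φ.injective (by simp [h.map_right, h'.right_add])
  right_smul z ξ b := Φ.injective (by simp [h.map_right, h'.right_smul])
  right_add' ξ b c := Φ.injective (by simp [h.map_right, h'.right_add'])
  right_smul' z ξ b := Φ.injective (by simp [h.map_right, h'.right_smul'])
  right_mul ξ b c := Φ.injective (by simp [h.map_right, h'.right_mul])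
  right_one ξ := Φ.injective (by simp [h.map_right, h'.right_one])
  inner_add ξ η ζ := by simp [← h.inner_map, h'.inner_add]
  inner_smul z ξ η := by simp [← h.inner_map, h'.inner_smul]
  inner_right ξ η b := by simp [← h.inner_map, h.map_right, h'.inner_right]
  star_inner ξ η := by simp [← h.inner_map, h'.star_inner]
  inner_self_nonneg ξ := by simpa [← h.inner_map] using h'.inner_self_nonneg (Φ ξ)
  inner_self_eq_zero ξ hξ := by
    rw [← h.inner_map] at hξ
    simpa using h'.inner_self_eq_zero _ hξ
  complete u hu := by
    obtain ⟨ξ, hξ⟩ := h'.complete (fun n => Φ (u n)) (by simpa [← h.inner_map] using hu)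
    exact ⟨Φ.symm ξ, by simpa [← h.inner_map] using hξ⟩
  left_add b ξ η := Φ.injective (by simp [h.map_left, h'.left_add])
  left_smul b z ξ := Φ.injective (by simp [h.map_left, h'.left_smul])
  left_add' b c ξ := Φ.injective (by simp [h.map_left, h'.left_add'])
  left_smul' z b ξ := Φ.injective (by simp [h.map_left, h'.left_smul'])
  left_mul b c ξ := Φ.injective (by simp [h.map_left, h'.left_mul])
  left_one ξ := Φ.injective (by simp [h.map_left, h'.left_one])
  left_right b ξ c := Φ.injective (by simp [h.map_left, h.map_right, h'.left_right])
  inner_left b ξ η := by simp [← h.inner_map, h.map_left, h'.inner_left]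

end CompletenessAndTransfer

/-! ### The map Φ and the comparison of the two inner products -/

section EdgeIso

variable {H : Type u} [CStarAlgebra H] [FiniteQuantumGroup H]

open Coalgebra

/-- Writing ξ = ∑ eᵢ ⊗ bᵢ with (eᵢ) orthonormal reduces the slice to ∑ bᵢ* bᵢ, a sum of positive
elements. -/
theorem exists_sliceLeft_star_mul_self (ξ : H ⊗[ℂ] H) :
    ∃ b, sliceLeft H (star ξ * ξ) = star b * b := by
  set e := stdOrthonormalBasis ℂ (L2 H)
  obtain ⟨b, rfl⟩ := exists_eq_sum_tmul e ξ
  obtain ⟨c, hc⟩ := exists_star_mul_self_eq_sum Finset.univ b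
  refine ⟨c, hc ▸ ?_⟩
  have h : ∀ i j, oneForm H (star ((toL2 H).symm (e i)) * (toL2 H).symm (e j)) =
      if i = j then 1 else 0 := fun i j => by
    rw [← L2.inner_def, LinearEquiv.apply_symm_apply, LinearEquiv.apply_symm_apply,
      e.inner_eq_ite]
  simp [star_sum, Finset.sum_mul_sum, h]

theorem isCStarCorrespondence_vergniouxCorrespondence (P : CentralProjection H) :
    IsCStarCorrespondence (vergniouxCorrespondence P) := by
  have hadd : ∀ ξ η ζ, (vergniouxCorrespondence P).inner ξ (η + ζ) =
      (vergniouxCorrespondence P).inner ξ η + (vergniouxCorrespondence P).inner ξ ζ :=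
    fun ξ η ζ => by simp [vergniouxCorrespondence, mul_add]
  have hsmul : ∀ (z : ℂ) ξ η, (vergniouxCorrespondence P).inner ξ (z • η) =
      z • (vergniouxCorrespondence P).inner ξ η :=
    fun z ξ η => by simp [vergniouxCorrespondence]
  have hstar : ∀ ξ η, star ((vergniouxCorrespondence P).inner ξ η) =
      (vergniouxCorrespondence P).inner η ξ := fun ξ η => by
    change star (sliceLeft H _) = sliceLeft H _
    rw [← sliceLeft_star, star_mul, star_star]
  have hpos : ∀ ξ, ∃ b, (vergniouxCorrespondence P).inner ξ ξ = star b * b :=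
    fun ξ => exists_sliceLeft_star_mul_self ξ.1
  have hdef : ∀ ξ, (vergniouxCorrespondence P).inner ξ ξ = 0 → ξ = 0 := fun ξ h => by
    apply Subtype.ext
    apply oneFormTensor_faithful
    rw [← oneForm_lid_rTensor]
    exact (congrArg (oneForm H) h).trans (map_zero _)
  exact
    { right_add := fun ξ η b => Subtype.ext (add_mul _ _ _)
      right_smul := fun z ξ b => Subtype.ext (smul_mul_assoc _ _ _)
      right_add' := fun ξ b c => Subtype.ext (by
        simp [vergniouxCorrespondence, TensorProduct.tmul_add, mul_add])
      right_smul' := fun z ξ b => Subtype.ext (by simp [vergniouxCorrespondence])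
      right_mul := fun ξ b c => Subtype.ext (by
        simp [vergniouxCorrespondence, mul_assoc])
      right_one := fun ξ => Subtype.ext (mul_one _)
      inner_add := hadd
      inner_smul := hsmul
      inner_right := fun ξ η b => by
        change sliceLeft H (star ξ.1 * (η.1 * (1 ⊗ₜ b))) = sliceLeft H (star ξ.1 * η.1) * b
        rw [← mul_assoc, sliceLeft_mul']
      star_inner := hstar
      inner_self_nonneg := hpos
      inner_self_eq_zero := hdef
      complete := complete_of_positive_definite _ hadd hsmul hstar hpos hdef
      left_add := fun b ξ η => Subtype.ext (mul_add _ _ _)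
      left_smul := fun b z ξ => Subtype.ext (mul_smul_comm _ _ _)
      left_add' := fun b c ξ => Subtype.ext (by simp [vergniouxCorrespondence, add_mul])
      left_smul' := fun z b ξ => Subtype.ext (by simp [vergniouxCorrespondence])
      left_mul := fun b c ξ => Subtype.ext (by simp [vergniouxCorrespondence, mul_assoc])
      left_one := fun ξ => Subtype.ext (by simp [vergniouxCorrespondence])
      left_right := fun b ξ c => Subtype.ext (mul_assoc _ _ _).symm
      inner_left := fun b ξ η => by
        simp only [vergniouxCorrespondence, star_mul, map_star, mul_assoc] }

/-- The map `a ⊗ b ↦ Δ(a)(1 ⊗ b)(P ⊗ 1)` onto `P C(𝔾) ⊗ C(𝔾)`. -/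
def edgeMap (P : CentralProjection H) : H ⊗[ℂ] H →ₗ[ℂ] (vergniouxTriple P).space :=
  (LinearMap.mulLeft ℂ (P.val ⊗ₜ[ℂ] (1 : H))).rangeRestrict ∘ₗ comulMul H

theorem edgeMap_surjective (P : CentralProjection H) : Function.Surjective (edgeMap P) :=
  (LinearMap.surjective_rangeRestrict _).comp comulMul_surjective

theorem coe_edgeMap (P : CentralProjection H) (ξ : H ⊗[ℂ] H) :
    (edgeMap P ξ : H ⊗[ℂ] H) = (P.val ⊗ₜ 1) * comulMul H ξ := rfl

theorem coe_edgeMap_tmul (P : CentralProjection H) (a b : H) :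
    (edgeMap P (a ⊗ₜ b) : H ⊗[ℂ] H) = Δ H a * (1 ⊗ₜ b) * (P.val ⊗ₜ 1) := by
  rw [coe_edgeMap, P.commute_tmul_one, comulMul_tmul]
  rfl

/-- Centrality of P merges the two comultiplications into Δ(a* c), and the outer legs b*, d leave
the slice. The density of P ⋆ · is S(P), hence the need for S(P) = P. -/
theorem inner_edgeMap {P : CentralProjection H} (hP : antipode P.val = P.val)
    (ξ η : H ⊗[ℂ] H) :
    (vergniouxCorrespondence P).inner (edgeMap P ξ) (edgeMap P η) =
      edgeInner (convolution P.val) ξ η := by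
  change sliceLeft H (star (edgeMap P ξ : H ⊗[ℂ] H) * (edgeMap P η : H ⊗[ℂ] H)) = _
  rw [coe_edgeMap, coe_edgeMap, star_mul, mul_assoc, ← mul_assoc (star _) (_ ⊗ₜ _),
    TensorProduct.star_tmul, star_one, P.isStarProjection.isSelfAdjoint.star_eq,
    Algebra.TensorProduct.tmul_mul_tmul, P.isStarProjection.isIdempotentElem.eq, one_mul]
  induction ξ with
  | zero => simp [edgeInner]
  | add x y hx hy =>
    simp only [edgeInner, star_add, map_add, add_mul, LinearMap.add_apply] at hx hy ⊢
    rw [hx, hy]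
  | tmul a b =>
    induction η with
    | zero => simp [edgeInner]
    | add x y hx hy =>
      simp only [edgeInner, mul_add, map_add] at hx hy ⊢
      rw [hx, hy]
    | tmul c d =>
      rw [edgeInner_tmul, comulMul_tmul, comulMul_tmul, star_mul, TensorProduct.star_tmul,
        star_one, mul_assoc, sliceLeft_mul, ← FiniteQuantumGroup.comul_star, ← mul_assoc (_ ⊗ₜ _),
        ← mul_assoc, sliceLeft_mul', ← mul_assoc, P.commute_tmul_one,
        ← mul_assoc (comul _) (comul _), ← FiniteQuantumGroup.comul_mul, ← P.commute_tmul_one,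
        convolution, leftConv_density, hP, mul_assoc]

/-- The inner product of K is definite, so the inner-product-preserving `edgeMap` vanishes exactly
on the radical. -/
theorem ker_edgeMap {P : CentralProjection H} (hP : antipode P.val = P.val) :
    LinearMap.ker (edgeMap P) = edgeNull (convolution P.val) := by
  have hK := isCStarCorrespondence_vergniouxCorrespondence P
  ext ξ
  constructor
  · intro h η
    rw [LinearMap.mem_ker] at h
    rw [← inner_edgeMap hP, ← inner_edgeMap hP, h]
    simp [vergniouxCorrespondence]
  · intro h
    exact hK.inner_self_eq_zero _ ((inner_edgeMap hP ξ ξ).trans (h ξ).1)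

/-- The isomorphism `E_A ≃ K` induced by `edgeMap`. -/
def edgeEquiv {P : CentralProjection H} (hP : antipode P.val = P.val) :
    EdgeSpace (convolution P.val) ≃ₗ[ℂ] (vergniouxTriple P).space :=
  (Submodule.quotEquivOfEq _ _ (ker_edgeMap hP).symm).trans
    ((edgeMap P).quotKerEquivOfSurjective (edgeMap_surjective P))

theorem edgeEquiv_mk {P : CentralProjection H} (hP : antipode P.val = P.val) (ξ : H ⊗[ℂ] H) :
    edgeEquiv hP (Submodule.Quotient.mk ξ) = edgeMap P ξ := rfl

theorem isCorrespondenceIso_edgeEquiv {P : CentralProjection H} (hP : antipode P.val = P.val) :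
    IsCorrespondenceIso (edgeCorrespondence (convolution P.val)) (vergniouxCorrespondence P)
      (edgeEquiv hP) where
  map_left f ξ := by
    induction ξ using Submodule.Quotient.induction_on with | _ ξ
    change edgeEquiv hP (Submodule.Quotient.mk _) = _
    rw [edgeEquiv_mk, edgeEquiv_mk]
    apply Subtype.ext
    change (P.val ⊗ₜ 1) * comulMul H ((f ⊗ₜ 1) * ξ) =
      comul (R := ℂ) f * ((P.val ⊗ₜ 1) * comulMul H ξ)
    have h : comulMul H ((f ⊗ₜ 1) * ξ) = comul (R := ℂ) f * comulMul H ξ := by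
      induction ξ with
      | zero => simp
      | add x y hx hy => simp only [mul_add, map_add, hx, hy]
      | tmul a b => simp [comulMul_tmul, FiniteQuantumGroup.comul_mul, mul_assoc]
    rw [h, ← mul_assoc, P.commute_tmul_one, mul_assoc]
  map_right ξ f := by
    induction ξ using Submodule.Quotient.induction_on with | _ ξ
    change edgeEquiv hP (Submodule.Quotient.mk _) = _
    rw [edgeEquiv_mk, edgeEquiv_mk]
    apply Subtype.ext
    change (P.val ⊗ₜ 1) * comulMul H (ξ * (1 ⊗ₜ f)) = (P.val ⊗ₜ 1) * comulMul H ξ * (1 ⊗ₜ f)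
    have h : comulMul H (ξ * (1 ⊗ₜ f)) = comulMul H ξ * (1 ⊗ₜ f) := by
      induction ξ with
      | zero => simp
      | add x y hx hy => simp only [add_mul, map_add, hx, hy]
      | tmul a b => simp [comulMul_tmul, mul_assoc]
    rw [h, mul_assoc]
  inner_map ξ η := by
    induction ξ using Submodule.Quotient.induction_on with | _ ξ
    induction η using Submodule.Quotient.induction_on with | _ η
    exact inner_edgeMap hP ξ η

end EdgeIso

/-! ## Irreducible representations -/

section RepresentationTheory

variable {H : Type u} [CStarAlgebra H]

open scoped Matrix ComplexOrder

namespace UnitaryRep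

/-- Schur's lemma: an eigenspace of M is invariant and nonzero, hence everything. -/
theorem IsIrreducible.exists_eq_smul_one {π : UnitaryRep H} (hπ : π.IsIrreducible)
    {M : Matrix (Fin π.dim) (Fin π.dim) ℂ} (hM : ∀ a, M * π.hom a = π.hom a * M) :
    ∃ c : ℂ, M = c • 1 := by
  have : Nonempty (Fin π.dim) := ⟨⟨0, hπ.1⟩⟩
  obtain ⟨c, hc⟩ := Module.End.exists_eigenvalue (Matrix.toLin' M)
  refine ⟨c, ?_⟩
  have h := (hπ.2 (Module.End.eigenspace (Matrix.toLin' M) c) fun a v hv => by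
    rw [Module.End.mem_eigenspace_iff, Matrix.toLin'_apply] at hv ⊢
    rw [Matrix.mulVec_mulVec, hM, ← Matrix.mulVec_mulVec, hv, Matrix.mulVec_smul]).resolve_left hc
  refine Matrix.toLin'.injective (LinearMap.ext fun v => ?_)
  have hv : Matrix.toLin' M v = c • v := by
    rw [← Module.End.mem_eigenspace_iff, h]; trivial
  rw [hv, map_smul, Matrix.toLin'_one]
  rfl

/-- By Schur's lemma TᴴT and TTᴴ are scalars; they coincide because both compute TTᴴT, and the
common value r is positive as T ≠ 0. Then T/√r is unitary. -/
theorem IsIrreducible.isEquivalent {π ρ : UnitaryRep H} (hπ : π.IsIrreducible)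
    (hρ : ρ.IsIrreducible) {T : Matrix (Fin ρ.dim) (Fin π.dim) ℂ} (hT : T ≠ 0)
    (h : ∀ a, T * π.hom a = ρ.hom a * T) : π.IsEquivalent ρ := by
  have h' : ∀ a, Tᴴ * ρ.hom a = π.hom a * Tᴴ := fun a => by
    have h1 := congrArg Matrix.conjTranspose (h (star a))
    rw [Matrix.conjTranspose_mul, Matrix.conjTranspose_mul, map_star, map_star,
      Matrix.star_eq_conjTranspose, Matrix.star_eq_conjTranspose,
      Matrix.conjTranspose_conjTranspose, Matrix.conjTranspose_conjTranspose] at h1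
    exact h1.symm
  obtain ⟨c, hc⟩ := hπ.exists_eq_smul_one (M := Tᴴ * T) fun a => by
    rw [Matrix.mul_assoc, h, ← Matrix.mul_assoc, h', Matrix.mul_assoc]
  obtain ⟨d, hd⟩ := hρ.exists_eq_smul_one (M := T * Tᴴ) fun a => by
    rw [Matrix.mul_assoc, h', ← Matrix.mul_assoc, h, Matrix.mul_assoc]
  have hdc : d = c := by
    have h1 : d • T = c • T := by
      rw [← Matrix.one_mul T, ← Matrix.smul_mul, ← hd, Matrix.mul_assoc, hc, Matrix.mul_smul,
        Matrix.mul_one, Matrix.one_mul]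
    exact smul_left_injective ℂ hT h1
  obtain ⟨r, hr, rfl⟩ : ∃ r : ℝ, 0 < r ∧ c = r := by
    let i : Fin π.dim := ⟨0, hπ.1⟩
    have h1 : c = ((∑ k, Complex.normSq (T k i) : ℝ) : ℂ) := by
      have h2 := congrFun (congrFun hc i) i
      simp only [Matrix.mul_apply, Matrix.conjTranspose_apply, Matrix.smul_apply,
        Matrix.one_apply_eq, smul_eq_mul, mul_one] at h2
      rw [← h2, Complex.ofReal_sum]
      refine Finset.sum_congr rfl fun k _ => ?_
      rw [Complex.normSq_eq_conj_mul_self]; rfl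
    refine ⟨_, lt_of_le_of_ne (Finset.sum_nonneg fun k _ => Complex.normSq_nonneg _) ?_, h1⟩
    intro h0
    rw [← h0, Complex.ofReal_zero] at h1
    rw [h1, zero_smul, Matrix.conjTranspose_mul_self_eq_zero] at hc
    exact hT hc
  have hs : ((Real.sqrt r)⁻¹ : ℂ) * ((Real.sqrt r)⁻¹ : ℂ) * r = 1 := by
    rw [← mul_inv, ← Complex.ofReal_mul, Real.mul_self_sqrt hr.le]
    exact inv_mul_cancel₀ (by exact_mod_cast hr.ne')
  have hstar : star ((Real.sqrt r)⁻¹ : ℂ) = ((Real.sqrt r)⁻¹ : ℂ) := by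
    rw [← Complex.ofReal_inv]; exact Complex.conj_ofReal _
  refine ⟨((Real.sqrt r)⁻¹ : ℂ) • T, ?_, ?_, fun a => ?_⟩
  · rw [Matrix.conjTranspose_smul, Matrix.smul_mul, Matrix.mul_smul, hc, smul_smul, smul_smul,
      hstar, hs, one_smul]
  · rw [Matrix.conjTranspose_smul, Matrix.smul_mul, Matrix.mul_smul, hd, hdc, smul_smul, smul_smul,
      hstar, hs, one_smul]
  · rw [Matrix.smul_mul, h, Matrix.mul_smul]

theorem IsEquivalent.hom_eq_zero_iff {π ρ : UnitaryRep H} (h : π.IsEquivalent ρ) (a : H) :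
    π.hom a = 0 ↔ ρ.hom a = 0 := by
  obtain ⟨V, h1, h2, h3⟩ := h
  constructor
  · intro h0
    rw [← Matrix.mul_one (ρ.hom a), ← h2, ← Matrix.mul_assoc, ← h3, h0, Matrix.mul_zero,
      Matrix.zero_mul]
  · intro h0
    rw [← Matrix.one_mul (π.hom a), ← h1, Matrix.mul_assoc, h3, h0, Matrix.zero_mul,
      Matrix.mul_zero]

variable [FiniteQuantumGroup H]

theorem IsConjugate.hom_eq_zero_iff {π ρ : UnitaryRep H} (h : π.IsConjugate ρ) (a : H) :
    ρ.hom a = 0 ↔ π.hom (antipode a) = 0 := by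
  obtain ⟨T, T', h1, h2, h3⟩ := h
  refine Iff.trans ⟨fun h0 => ?_, fun h0 => ?_⟩ Matrix.transpose_eq_zero
  · rw [← Matrix.mul_one (π.hom (antipode a))ᵀ, ← h1, ← Matrix.mul_assoc, ← h3, h0,
      Matrix.mul_zero, Matrix.zero_mul]
  · rw [← Matrix.one_mul (ρ.hom a), ← h2, Matrix.mul_assoc, h3, h0, Matrix.zero_mul,
      Matrix.mul_zero]

/-- The contragredient `a ↦ π(S(a))ᵀ` of a representation. -/
def contragredient (π : UnitaryRep H) : UnitaryRep H where
  dim := π.dim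
  hom :=
    { toFun := fun a => (π.hom (antipode a))ᵀ
      map_one' := by rw [antipode_one, map_one, Matrix.transpose_one]
      map_mul' := fun a b => by rw [antipode_mul, map_mul, Matrix.transpose_mul]
      map_zero' := by rw [map_zero, map_zero, Matrix.transpose_zero]
      map_add' := fun a b => by rw [map_add, map_add, Matrix.transpose_add]
      commutes' := fun z => by
        rw [Algebra.algebraMap_eq_smul_one, map_smul, antipode_one, map_smul, map_one,
          Matrix.transpose_smul, Matrix.transpose_one, Algebra.algebraMap_eq_smul_one]
      map_star' := fun a => by
        rw [antipode_star, map_star]; rfl }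

theorem isConjugate_contragredient (π : UnitaryRep H) : π.IsConjugate π.contragredient :=
  ⟨(1 : Matrix (Fin π.dim) (Fin π.dim) ℂ), (1 : Matrix (Fin π.dim) (Fin π.dim) ℂ),
    Matrix.one_mul _, Matrix.one_mul _, fun _ => (Matrix.one_mul _).trans (Matrix.mul_one _).symm⟩

theorem contragredient_isConjugate (π : UnitaryRep H) : π.contragredient.IsConjugate π :=
  ⟨(1 : Matrix (Fin π.dim) (Fin π.dim) ℂ), (1 : Matrix (Fin π.dim) (Fin π.dim) ℂ),
    Matrix.one_mul _, Matrix.one_mul _, fun a => by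
      change (1 : Matrix (Fin π.dim) (Fin π.dim) ℂ) * π.hom a =
        ((π.hom (antipode (antipode a)))ᵀ)ᵀ * (1 : Matrix (Fin π.dim) (Fin π.dim) ℂ)
      rw [antipode_antipode, Matrix.transpose_transpose]
      exact (Matrix.one_mul _).trans (Matrix.mul_one _).symm⟩

theorem IsIrreducible.contragredient {π : UnitaryRep H} (hπ : π.IsIrreducible) :
    π.contragredient.IsIrreducible := by
  refine ⟨hπ.1, ?_⟩
  change ∀ W : Submodule ℂ (Fin π.dim → ℂ),
    (∀ a, ∀ v ∈ W, (π.hom (antipode a))ᵀ *ᵥ v ∈ W) → W = ⊥ ∨ W = ⊤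
  intro W hW
  -- Entrywise conjugation exchanges the two invariance conditions: π(S(S(a*)))ᵀ applied to the
  -- conjugate of v is the conjugate of π(a)v.
  let W' : Submodule ℂ (Fin π.dim → ℂ) :=
    { carrier := {v | star v ∈ W}
      zero_mem' := by simp
      add_mem' := fun {v w} hv hw => by
        simp only [Set.mem_ofPred_eq, star_add] at hv hw ⊢
        exact W.add_mem hv hw
      smul_mem' := fun z v hv => by
        simp only [Set.mem_ofPred_eq, star_smul] at hv ⊢
        exact W.smul_mem _ hv }
  have h := hπ.2 W' fun a v hv => by
    have h1 := hW (antipode (star a)) (star v) hv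
    rw [antipode_antipode, Matrix.mulVec_transpose, map_star,
      Matrix.star_eq_conjTranspose, ← Matrix.star_mulVec] at h1
    exact h1
  refine h.imp (fun h => ?_) (fun h => ?_)
  · rw [Submodule.eq_bot_iff] at h ⊢
    intro v hv
    rw [← star_star v, h (star v) (by change star (star v) ∈ W; rwa [star_star]), star_zero]
  · rw [Submodule.eq_top_iff'] at h ⊢
    intro v
    have h1 : star (star v) ∈ W := h (star v)
    rwa [star_star] at h1

/-- If there is no nonzero intertwiner from `π` to `ρ`, then `ρ` vanishes on every `z` that
annihilates the kernel of `π`. -/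
theorem hom_eq_zero_of_intertwiner_eq_zero {π ρ : UnitaryRep H}
    (h : ∀ T : Matrix (Fin ρ.dim) (Fin π.dim) ℂ, (∀ a, T * π.hom a = ρ.hom a * T) → T = 0)
    {z : H} (hz : ∀ x, π.hom x = 0 → z * x = 0) : ρ.hom z = 0 := by
  set e := stdOrthonormalBasis ℂ (L2 H)
  set b := fun i => (toL2 H).symm (e i) with hb
  -- The functional ψ(z ·) kills ker π by `hz`, so it factors through π.
  obtain ⟨ω, hω⟩ : ∃ ω : Matrix (Fin π.dim) (Fin π.dim) ℂ →ₗ[ℂ] ℂ,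
      ∀ x, ω (π.hom x) = oneForm H (z * x) := by
    have h1 : density z ∈ LinearMap.range (LinearMap.dualMap (π.hom.toAlgHom.toLinearMap)) := by
      rw [LinearMap.range_dualMap_eq_dualAnnihilator_ker, Submodule.mem_dualAnnihilator]
      intro x hx
      change oneForm H (z * x) = 0
      rw [hz x hx, map_zero]
    obtain ⟨ω, hω⟩ := h1
    exact ⟨ω, fun x => congrArg (fun f => f x) hω⟩
  have hexp : ∀ x, x = ∑ i, oneForm H (star (b i) * x) • b i := fun x => by
    have h1 := congrArg (toL2 H).symm (e.sum_repr' (toL2 H x))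
    rw [LinearEquiv.symm_apply_apply, map_sum] at h1
    rw [← h1]
    refine Finset.sum_congr rfl fun i _ => ?_
    rw [map_smul, h1, hb, ← L2.inner_def, LinearEquiv.apply_symm_apply]
  -- Averaging X over the Casimir element ∑ bᵢ* ⊗ bᵢ produces an intertwiner from π to ρ, which is
  -- zero by `h`.
  have hzero : ∀ X : Matrix (Fin ρ.dim) (Fin π.dim) ℂ,
      ∑ i, ρ.hom (star (b i)) * X * π.hom (b i) = 0 := by
    intro X
    apply h
    intro a
    have h1 : ∀ i, ρ.hom a * (ρ.hom (star (b i)) * X * π.hom (b i)) =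
        ∑ j, oneForm H (star (b i) * (b j * a)) • (ρ.hom (star (b j)) * X * π.hom (b i)) := by
      intro i
      rw [← Matrix.mul_assoc, ← Matrix.mul_assoc, ← map_mul,
        ← sum_oneForm_mul_smul_star e (a * star (b i)), map_sum, Matrix.sum_mul, Matrix.sum_mul]
      refine Finset.sum_congr rfl fun j _ => ?_
      rw [map_smul, Matrix.smul_mul, Matrix.smul_mul, oneForm_mul_comm, ← mul_assoc,
        oneForm_mul_comm (_ * a)]
    have h2 : ∀ j, ρ.hom (star (b j)) * X * π.hom (b j) * π.hom a =
        ∑ i, oneForm H (star (b i) * (b j * a)) • (ρ.hom (star (b j)) * X * π.hom (b i)) := by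
      intro j
      rw [Matrix.mul_assoc, ← map_mul]
      conv_lhs => rw [hexp (b j * a)]
      rw [map_sum, Matrix.mul_sum]
      refine Finset.sum_congr rfl fun i _ => ?_
      rw [map_smul, Matrix.mul_smul]
    rw [Matrix.mul_sum, Matrix.sum_mul, Finset.sum_congr rfl fun i _ => h1 i,
      Finset.sum_congr rfl fun i _ => h2 i, Finset.sum_comm]
  ext k l
  rw [← sum_oneForm_mul_smul_star e z]
  have hωe : ∀ M, ω M = ∑ m, ∑ n, M m n * ω (Matrix.single m n 1) := fun M => by
    conv_lhs => rw [Matrix.matrix_eq_sum_single M]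
    simp only [map_sum]
    refine Finset.sum_congr rfl fun m _ => Finset.sum_congr rfl fun n _ => ?_
    rw [← smul_eq_mul, ← map_smul, Matrix.smul_single, smul_eq_mul, mul_one]
  -- Taking X to be a matrix unit isolates products of single matrix coefficients. Then ρ(z) = ∑
  -- ω(π(bᵢ))ρ(bᵢ*) is a combination of these vanishing sums.
  have hkl : ∀ m n, ∑ i, ρ.hom (star (b i)) k l * π.hom (b i) m n = 0 := fun m n => by
    have h1 := congrFun (congrFun (hzero (Matrix.single l m 1)) k) n
    rw [Matrix.sum_apply] at h1
    rw [← Matrix.zero_apply (α := ℂ) k n, ← h1]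
    refine Finset.sum_congr rfl fun i _ => ?_
    rw [Matrix.mul_apply]
    simp [Matrix.mul_apply, Matrix.single_apply, ite_and]
  rw [map_sum, Matrix.sum_apply]
  simp only [map_smul, Matrix.smul_apply, smul_eq_mul, Matrix.zero_apply]
  calc ∑ i, oneForm H (z * b i) * ρ.hom (star (b i)) k l
      = ∑ m, ∑ n, (∑ i, ρ.hom (star (b i)) k l * π.hom (b i) m n) *
          ω (Matrix.single m n 1) := by
        have h1 : ∀ i, oneForm H (z * b i) =
            ∑ m, ∑ n, π.hom (b i) m n * ω (Matrix.single m n 1) := fun i => by rw [← hω, hωe]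
        simp only [h1, Finset.sum_mul]
        rw [Finset.sum_comm]
        refine Finset.sum_congr rfl fun m _ => ?_
        rw [Finset.sum_comm]
        refine Finset.sum_congr rfl fun n _ => Finset.sum_congr rfl fun i _ => by ring
    _ = 0 := by simp [hkl]

end UnitaryRep

end RepresentationTheory

/-! ## Subrepresentations of the regular representation -/

section RegularRepresentation

variable {H : Type u} [CStarAlgebra H]

/-- Left multiplication on `ℓ²`. -/
def regular (a : H) : L2 H →ₗ[ℂ] L2 H :=
  (toL2 H).toLinearMap ∘ₗ LinearMap.mulLeft ℂ a ∘ₗ (toL2 H).symm.toLinearMap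

@[simp]
theorem regular_toL2 (a x : H) : regular a (toL2 H x) = toL2 H (a * x) := rfl

theorem regular_mul (a b : H) (v : L2 H) : regular (a * b) v = regular a (regular b v) :=
  congrArg (toL2 H) (mul_assoc a b _)

variable [FiniteDimensional ℂ H]

theorem inner_regular (a : H) (v w : L2 H) :
    inner ℂ (regular a v) w = inner ℂ v (regular (star a) w) := by
  obtain ⟨x, rfl⟩ := (toL2 H).surjective v
  obtain ⟨y, rfl⟩ := (toL2 H).surjective w
  rw [regular_toL2, regular_toL2, L2.inner_def, L2.inner_def, star_mul, mul_assoc]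

/-- The representation on an invariant subspace of the regular representation. -/
def subregular (W : Submodule ℂ (L2 H)) (hW : ∀ a, ∀ v ∈ W, regular a v ∈ W) : UnitaryRep H where
  dim := Module.finrank ℂ W
  hom :=
    { toFun := fun a => LinearMap.toMatrixOrthonormal (stdOrthonormalBasis ℂ W)
        ((regular a).restrict (hW a))
      map_one' := by
        rw [← map_one (LinearMap.toMatrixOrthonormal (stdOrthonormalBasis ℂ W))]
        congr 1
        ext v
        exact one_mul ((toL2 H).symm v.1)
      map_mul' := fun a b => by
        rw [← map_mul]
        congr 1
        ext v
        exact regular_mul a b v.1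
      map_zero' := by
        rw [← map_zero (LinearMap.toMatrixOrthonormal (stdOrthonormalBasis ℂ W))]
        congr 1
        ext v
        exact zero_mul ((toL2 H).symm v.1)
      map_add' := fun a b => by
        rw [← map_add]
        congr 1
        ext v
        exact add_mul a b ((toL2 H).symm v.1)
      commutes' := fun z => by
        rw [← AlgHomClass.commutes (LinearMap.toMatrixOrthonormal (stdOrthonormalBasis ℂ W))]
        congr 1
        ext v
        rw [Algebra.algebraMap_eq_smul_one, Algebra.algebraMap_eq_smul_one]
        exact smul_one_mul z ((toL2 H).symm v.1)
      map_star' := fun a => by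
        refine Eq.trans (congrArg (LinearMap.toMatrix _ _) ?_) (LinearMap.toMatrix_adjoint
          (stdOrthonormalBasis ℂ W) (stdOrthonormalBasis ℂ W) ((regular a).restrict (hW a)))
        rw [LinearMap.eq_adjoint_iff]
        intro v w
        have h := inner_regular (star a) v.1 w.1
        rw [star_star] at h
        exact h }

theorem subregular_hom_eq_zero {W : Submodule ℂ (L2 H)} {hW : ∀ a, ∀ v ∈ W, regular a v ∈ W} {a : H}
    (h : (subregular W hW).hom a = 0) {v : L2 H} (hv : v ∈ W) : regular a v = 0 := by
  have h1 := (LinearMap.toMatrix (stdOrthonormalBasis ℂ W).toBasis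
    (stdOrthonormalBasis ℂ W).toBasis).map_eq_zero_iff.1 h
  exact congrArg Subtype.val (LinearMap.congr_fun h1 ⟨v, hv⟩)

/-- Orthonormal coordinates match the invariant subspaces of the matrix representation with the
invariant subspaces inside W, so minimality of W is irreducibility. -/
theorem subregular_isIrreducible {W : Submodule ℂ (L2 H)} (hW : ∀ a, ∀ v ∈ W, regular a v ∈ W)
    (hbot : W ≠ ⊥) (hmin : ∀ W' ≤ W, (∀ a, ∀ v ∈ W', regular a v ∈ W') → W' = ⊥ ∨ W' = W) :
    (subregular W hW).IsIrreducible := by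
  refine ⟨?_, ?_⟩
  · change 0 < Module.finrank ℂ W
    rwa [Nat.pos_iff_ne_zero, Ne, Submodule.finrank_eq_zero]
  change ∀ W' : Submodule ℂ (Fin (Module.finrank ℂ W) → ℂ), (∀ a, ∀ v ∈ W',
    (LinearMap.toMatrix (stdOrthonormalBasis ℂ W).toBasis (stdOrthonormalBasis ℂ W).toBasis
      ((regular a).restrict (hW a))).mulVec v ∈ W') → W' = ⊥ ∨ W' = ⊤
  intro W' hW'
  set e := (stdOrthonormalBasis ℂ W).toBasis
  let f : (Fin (Module.finrank ℂ W) → ℂ) →ₗ[ℂ] L2 H := W.subtype ∘ₗ e.equivFun.symm.toLinearMap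
  have hf : Function.Injective f := W.injective_subtype.comp e.equivFun.symm.injective
  have hle : W'.map f ≤ W := by
    rintro _ ⟨v, _, rfl⟩
    exact (e.equivFun.symm v).2
  have hinv : ∀ a, ∀ v ∈ W'.map f, regular a v ∈ W'.map f := by
    rintro a _ ⟨v, hv, rfl⟩
    refine ⟨_, hW' a v hv, ?_⟩
    obtain ⟨w, rfl⟩ := e.equivFun.surjective v
    have h1 := LinearMap.toMatrix_mulVec_repr e e ((regular a).restrict (hW a)) w
    simp only [f, LinearMap.comp_apply, LinearEquiv.coe_coe, LinearEquiv.symm_apply_apply]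
    change W.subtype (e.equivFun.symm (Matrix.mulVec _ (e.repr w))) = _
    rw [h1]
    change W.subtype (e.equivFun.symm (e.equivFun _)) = _
    rw [LinearEquiv.symm_apply_apply]
    rfl
  refine (hmin _ hle hinv).imp (fun h => ?_) (fun h => ?_)
  · exact (Submodule.map_injective_of_injective hf) (h.trans (Submodule.map_bot f).symm)
  · rw [Submodule.eq_top_iff']
    intro v
    have h1 : f v ∈ W'.map f := by rw [h]; exact (e.equivFun.symm v).2
    obtain ⟨w, hw, hwv⟩ := h1
    rwa [← hf hwv]

/-- The irreducible representations separate the points of a finite-dimensional C*-algebra. -/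
theorem eq_zero_of_forall_irredRep {x : H} (h : ∀ π : IrredRep H, π.1.hom x = 0) : x = 0 := by
  -- N is the largest invariant subspace on which x acts as zero. A nonzero orthogonal complement
  -- would contain an irreducible subspace; x vanishes there, so it would lie in N as well. Hence N
  -- is everything and contains 1.
  let N : Submodule ℂ (L2 H) := ⨅ a, LinearMap.ker (regular x ∘ₗ regular a)
  have hmem : ∀ v, v ∈ N ↔ ∀ a, regular x (regular a v) = 0 := fun v => by
    simp [N, Submodule.mem_iInf]
  have hN : ∀ a, ∀ v ∈ N, regular a v ∈ N := fun b v hv => by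
    rw [hmem] at hv ⊢
    intro a
    rw [← regular_mul a b, hv]
  have hN' : ∀ a, ∀ v ∈ Nᗮ, regular a v ∈ Nᗮ := fun a v hv w hw => by
    rw [← inner_conj_symm, inner_regular, inner_conj_symm]
    exact hv _ (hN _ w hw)
  have hbot : Nᗮ = ⊥ := by
    by_contra hne
    obtain ⟨W, ⟨hW0, hWN, hWinv⟩, hWmin⟩ := IsArtinian.set_has_minimal
      {W : Submodule ℂ (L2 H) | W ≠ ⊥ ∧ W ≤ Nᗮ ∧ ∀ a, ∀ v ∈ W, regular a v ∈ W}
      ⟨Nᗮ, hne, le_rfl, hN'⟩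
    have hirr := subregular_isIrreducible hWinv hW0 fun W' hle hinv => by
      by_contra! hc
      exact hWmin W' ⟨hc.1, hle.trans hWN, hinv⟩ (lt_of_le_of_ne hle hc.2)
    apply hW0
    rw [Submodule.eq_bot_iff]
    intro v hv
    have hvN : v ∈ N := (hmem v).2 fun a =>
      subregular_hom_eq_zero (h ⟨_, hirr⟩) (hWinv a v hv)
    exact inner_self_eq_zero.1 (hWN hv v hvN)
  have h1 : toL2 H 1 ∈ N := by
    rw [(Submodule.orthogonal_eq_bot_iff).1 hbot]
    trivial
  have h2 := (hmem _).1 h1 1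
  rw [regular_toL2, regular_toL2, mul_one, mul_one] at h2
  exact (toL2 H).map_eq_zero_iff.1 h2

/-- A self-adjoint two-sided ideal of a finite-dimensional C*-algebra is generated by a central
projection. -/
theorem exists_centralProjection_of_ideal (I : Submodule ℂ H) (hl : ∀ a, ∀ x ∈ I, a * x ∈ I)
    (hr : ∀ a, ∀ x ∈ I, x * a ∈ I) (hs : ∀ x ∈ I, star x ∈ I) :
    ∃ P : CentralProjection H, ∀ x, x ∈ I ↔ P.val * x = x := by
  -- The unit of the ideal is found as the orthogonal projection e of 1 onto I.
  obtain ⟨y, ⟨e, he, rfl⟩, z, hz, hyz⟩ :=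
    (I.map (toL2 H).toLinearMap).exists_add_mem_mem_orthogonal (toL2 H 1)
  obtain ⟨w, rfl⟩ := (toL2 H).surjective z
  have hw : w = 1 - e := eq_sub_of_add_eq' ((toL2 H).injective hyz).symm
  -- Since xx*w lies in I and w is orthogonal to I, ψ((x*w)*(x*w)) = 0, and ψ is faithful.
  have h1 : ∀ x ∈ I, star x * w = 0 := fun x hx => by
    apply oneForm_faithful
    have h2 := hz _ ⟨x * (star x * w), hr _ x hx, rfl⟩
    rw [star_mul, star_star, mul_assoc, ← mul_assoc x]
    rw [LinearEquiv.coe_coe, L2.inner_def, star_mul, mul_assoc, star_mul, star_star,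
      mul_assoc] at h2
    simpa [mul_assoc] using h2
  have h2 : ∀ x ∈ I, x * e = x := fun x hx => by
    have h3 := h1 _ (hs x hx)
    rw [star_star, hw, mul_sub, mul_one, sub_eq_zero] at h3
    exact h3.symm
  have hsa : star e = e := by
    have h3 := congrArg star (h2 _ (hs e he))
    rw [star_mul, star_star] at h3
    rw [← h2 _ (hs e he), h3]
  have h3 : ∀ x ∈ I, e * x = x := fun x hx => by
    apply star_injective
    rw [star_mul, hsa, h2 _ (hs x hx)]
  refine ⟨⟨e, ⟨h2 e he, hsa⟩, fun a => ?_⟩, fun x => ⟨h3 x, fun hx => hx ▸ hr _ e he⟩⟩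
  rw [← h3 _ (hl a e he), ← mul_assoc, h2 _ (hr a e he)]

end RegularRepresentation

/-! ## Central projections and sets of irreducible representations -/

section Support

variable {H : Type u} [CStarAlgebra H]

/-- The complement `1 - P` of a central projection. -/
def CentralProjection.compl (P : CentralProjection H) : CentralProjection H where
  val := 1 - P.val
  isStarProjection := P.isStarProjection.one_sub
  central a := by rw [sub_mul, mul_sub, P.central, one_mul, mul_one]

theorem CentralProjection.ext {P Q : CentralProjection H} (h : P.val = Q.val) : P = Q := by
  cases P; cases Q; congr

theorem IrredRep.cls_eq_iff {π ρ : IrredRep H} : π.cls = ρ.cls ↔ π.1.IsEquivalent ρ.1 :=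
  Quotient.eq

theorem IrredRep.one_ne_zero (π : IrredRep H) :
    (1 : Matrix (Fin π.1.dim) (Fin π.1.dim) ℂ) ≠ 0 := by
  intro h
  have h1 := congrFun (congrFun h ⟨0, π.2.1⟩) ⟨0, π.2.1⟩
  simp at h1

/-- A central element acts as a scalar by Schur's lemma, and an idempotent scalar is 0 or 1. -/
theorem IrredRep.hom_centralProjection (π : IrredRep H) (P : CentralProjection H) :
    π.1.hom P.val = 0 ∨ π.1.hom P.val = 1 := by
  obtain ⟨c, hc⟩ := π.2.exists_eq_smul_one (M := π.1.hom P.val) fun a => by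
    rw [← map_mul, P.central, map_mul]
  have h := congrArg π.1.hom P.isStarProjection.isIdempotentElem.eq
  rw [map_mul, hc, Matrix.smul_mul, Matrix.one_mul] at h
  rcases eq_or_ne c 0 with rfl | h0
  · left; rw [hc, zero_smul]
  · right
    rw [hc]
    exact smul_right_injective _ h0 h

theorem IrredRep.cls_mem_supp_iff {π : IrredRep H} {P : CentralProjection H} :
    π.cls ∈ P.supp ↔ π.1.hom P.val ≠ 0 := by
  constructor
  · rintro ⟨ρ, h, h0⟩
    rwa [Ne, ← (IrredRep.cls_eq_iff.1 h).hom_eq_zero_iff]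
  · exact fun h => ⟨π, rfl, h⟩

variable [FiniteQuantumGroup H]

theorem CentralProjection.eq_of_forall_irredRep {P Q : CentralProjection H}
    (h : ∀ π : IrredRep H, π.1.hom P.val = π.1.hom Q.val) : P = Q :=
  CentralProjection.ext (sub_eq_zero.1 (eq_zero_of_forall_irredRep fun π => by
    rw [map_sub, h, sub_self]))

/-- The central support of an irreducible representation. -/
theorem IrredRep.exists_support (π : IrredRep H) : ∃ z : H, π.1.hom z = 1 ∧
    ∀ ρ : IrredRep H, ¬ π.1.IsEquivalent ρ.1 → ρ.1.hom z = 0 := by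
  obtain ⟨e, he⟩ := exists_centralProjection_of_ideal
    (LinearMap.ker π.1.hom.toAlgHom.toLinearMap)
    (fun a x hx => by
      change π.1.hom (a * x) = 0
      rw [map_mul, show π.1.hom x = 0 from hx, mul_zero])
    (fun a x hx => by
      change π.1.hom (x * a) = 0
      rw [map_mul, show π.1.hom x = 0 from hx, zero_mul])
    (fun x hx => by
      change π.1.hom (star x) = 0
      rw [map_star, show π.1.hom x = 0 from hx, star_zero])
  have h1 : π.1.hom e.val = 0 := (he e.val).2 e.isStarProjection.isIdempotentElem.eq
  -- Here e is the unit of ker π, so 1 − e annihilates ker π; inequivalence excludes nonzero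
  -- intertwiners to ρ.
  refine ⟨1 - e.val, by rw [map_sub, h1, map_one, sub_zero], fun ρ hρ => ?_⟩
  refine UnitaryRep.hom_eq_zero_of_intertwiner_eq_zero (π := π.1) (fun T hT => ?_) fun x hx => ?_
  · by_contra h0
    exact hρ (π.2.isEquivalent ρ.2 h0 hT)
  · rw [sub_mul, one_mul, (he x).1 hx, sub_self]

theorem exists_centralProjection (S : Set (Irr H)) : ∃ P : CentralProjection H,
    ∀ π : IrredRep H, (π.cls ∈ S → π.1.hom P.val = 1) ∧ (π.cls ∉ S → π.1.hom P.val = 0) := by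
  -- P is the complement of the unit e of the common kernel I of the representations in S.
  let I : Submodule ℂ H := ⨅ π : {π : IrredRep H // π.cls ∈ S},
    LinearMap.ker π.1.1.hom.toAlgHom.toLinearMap
  have hI : ∀ x, x ∈ I ↔ ∀ π : IrredRep H, π.cls ∈ S → π.1.hom x = 0 := fun x => by
    simp only [I, Submodule.mem_iInf, Subtype.forall]
    rfl
  obtain ⟨e, he⟩ := exists_centralProjection_of_ideal I
    (fun a x hx => (hI _).2 fun π hπ => by rw [map_mul, (hI x).1 hx π hπ, mul_zero])
    (fun a x hx => (hI _).2 fun π hπ => by rw [map_mul, (hI x).1 hx π hπ, zero_mul])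
    (fun x hx => (hI _).2 fun π hπ => by rw [map_star, (hI x).1 hx π hπ, star_zero])
  refine ⟨e.compl, fun π => ⟨fun hπ => ?_, fun hπ => ?_⟩⟩
  · have h1 := (hI e.val).1 ((he e.val).2 e.isStarProjection.isIdempotentElem.eq) π hπ
    rw [CentralProjection.compl, map_sub, h1, map_one, sub_zero]
  -- For π outside S its support z lies in I, so ez = z and π(e) = 1.
  · obtain ⟨z, hz1, hz⟩ := π.exists_support
    have h1 : z ∈ I := (hI z).2 fun ρ hρ => hz ρ fun h =>
      hπ (IrredRep.cls_eq_iff.2 h ▸ hρ)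
    have h2 := congrArg π.1.hom ((he z).1 h1)
    rw [map_mul, hz1, mul_one] at h2
    rw [CentralProjection.compl, map_sub, h2, map_one, sub_self]

theorem centralProjection_spec (S : Set (Irr H)) (π : IrredRep H) :
    (π.cls ∈ S → π.1.hom (centralProjection S).val = 1) ∧
      (π.cls ∉ S → π.1.hom (centralProjection S).val = 0) :=
  Classical.epsilon_spec (exists_centralProjection S) π

theorem supp_centralProjection (S : Set (Irr H)) : (centralProjection S).supp = S := by
  ext α
  obtain ⟨π, rfl⟩ := Quotient.exists_rep α
  change π.cls ∈ _ ↔ π.cls ∈ S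
  rw [IrredRep.cls_mem_supp_iff]
  refine ⟨fun h => by_contra fun h' => h ((centralProjection_spec S π).2 h'), fun h => ?_⟩
  rw [(centralProjection_spec S π).1 h]
  exact π.one_ne_zero

theorem centralProjection_injective :
    Function.Injective (centralProjection : Set (Irr H) → CentralProjection H) :=
  Function.LeftInverse.injective supp_centralProjection

/-- Each irreducible representation takes only the values 0 and 1 on central projections, and
together they separate points. -/
theorem centralProjection_supp (P : CentralProjection H) : centralProjection P.supp = P := by
  refine CentralProjection.eq_of_forall_irredRep fun π => ?_
  rcases π.hom_centralProjection P with h | h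
  · rw [h, (centralProjection_spec _ π).2 fun h' => IrredRep.cls_mem_supp_iff.1 h' h]
  · rw [h, (centralProjection_spec _ π).1 (IrredRep.cls_mem_supp_iff.2 (h ▸ π.one_ne_zero))]

/-- The image of a central projection under the antipode. -/
def CentralProjection.antipode (P : CentralProjection H) : CentralProjection H where
  val := FiniteQuantumGroup.antipode P.val
  isStarProjection :=
    ⟨by rw [IsIdempotentElem, ← antipode_mul, P.isStarProjection.isIdempotentElem.eq],
      by rw [IsSelfAdjoint, ← antipode_star, P.isStarProjection.isSelfAdjoint.star_eq]⟩
  central a := by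
    rw [← antipode_antipode a, ← antipode_mul, ← antipode_mul, P.central]

/-- The contragredient of an irreducible representation. -/
def IrredRep.contragredient (π : IrredRep H) : IrredRep H :=
  ⟨π.1.contragredient, π.2.contragredient⟩

/-- A conjugate of π vanishes at a exactly when π vanishes at S(a). The contragredient supplies the
witness for the reverse inclusion, with S² = id ensuring that conjugation is mutual. -/
theorem conjSet_supp (P : CentralProjection H) : conjSet P.supp = P.antipode.supp := by
  ext α
  constructor
  · rintro ⟨π, ρ, hπ, rfl, h⟩
    rw [IrredRep.cls_mem_supp_iff] at hπ ⊢
    rw [Ne, h.hom_eq_zero_iff]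
    change ¬ π.1.hom (FiniteQuantumGroup.antipode (FiniteQuantumGroup.antipode P.val)) = 0
    rwa [antipode_antipode]
  · obtain ⟨ρ, rfl⟩ := Quotient.exists_rep α
    change ρ.cls ∈ _ → ρ.cls ∈ _
    rw [IrredRep.cls_mem_supp_iff]
    intro h
    refine ⟨ρ.contragredient, ρ, ?_, rfl, ρ.1.contragredient_isConjugate⟩
    rw [IrredRep.cls_mem_supp_iff]
    exact fun h0 => h ((ρ.1.isConjugate_contragredient.hom_eq_zero_iff _).1 h0)

theorem isSymmetric_iff {S : Set (Irr H)} :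
    IsSymmetric S ↔ antipode (centralProjection S).val = (centralProjection S).val := by
  rw [IsSymmetric]
  nth_rw 1 [← supp_centralProjection S]
  rw [conjSet_supp]
  constructor
  · intro h
    have h1 := centralProjection_supp (centralProjection S).antipode
    rw [h] at h1
    exact congrArg CentralProjection.val h1.symm
  · intro h
    have h1 : (centralProjection S).antipode = centralProjection S := CentralProjection.ext h
    rw [h1, supp_centralProjection]

end Support

/-! ### Parametrisation of both families of graphs by sets of representations -/

section Bijections

variable {H : Type u} [CStarAlgebra H] [FiniteQuantumGroup H]

theorem convolution_centralProjection_injective :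
    Function.Injective (fun S : Set (Irr H) => convolution (centralProjection S).val) :=
  fun _ _ h => centralProjection_injective (CentralProjection.ext (convolution_injective h))

theorem bijOn_convolution_centralProjection :
    Set.BijOn (fun S : Set (Irr H) => convolution (centralProjection S).val)
      {S | IsSymmetric S} {A | IsCentralUndirectedCayley A} := by
  refine ⟨fun S hS => isCentralUndirectedCayley_convolution (isSymmetric_iff.1 hS),
    convolution_centralProjection_injective.injOn, ?_⟩
  rintro _ ⟨_, hA, P, rfl⟩
  refine ⟨P.supp, ?_, by simp only [centralProjection_supp]⟩
  rw [Set.mem_ofPred_eq, isSymmetric_iff, centralProjection_supp]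
  exact antipode_eq_of_isUndirected hA

/-- The source map at 1 is P ⊗ 1, from which the counit on the second leg recovers P. -/
theorem vergniouxTriple_injective : Function.Injective (vergniouxTriple (H := H)) := by
  intro P Q h
  have h1 : P.val ⊗ₜ[ℂ] (1 : H) = Q.val ⊗ₜ[ℂ] (1 : H) :=
    congrArg (fun Γ : GraphTriple H => (Γ.source 1 : H ⊗[ℂ] H)) h
  have h2 := congrArg (fun t => TensorProduct.rid ℂ H (Coalgebra.counit.lTensor H t)) h1
  apply CentralProjection.ext
  simpa [FiniteQuantumGroup.counit_one] using h2

variable (H) in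
/-- The bijection of symmetric generating sets with Vergnioux's quantum Cayley graphs. -/
def vergniouxEquiv : {S : Set (Irr H) // IsSymmetric S ∧ IsGenerating S} ≃
    {Γ : GraphTriple H // IsVergniouxGraph Γ} :=
  Equiv.ofBijective
    (fun S => ⟨vergniouxTriple (centralProjection S.1), S.1, S.2.1, S.2.2, rfl⟩)
    ⟨fun _ _ h => Subtype.ext
        (centralProjection_injective (vergniouxTriple_injective (congrArg Subtype.val h))),
      fun ⟨_, S, hS, hg, hΓ⟩ => ⟨⟨S, hS, hg⟩, Subtype.ext hΓ.symm⟩⟩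

variable (H) in
/-- The bijection of symmetric generating sets with generating central undirected quantum Cayley
graphs. -/
def cayleyEquiv : {S : Set (Irr H) // IsSymmetric S ∧ IsGenerating S} ≃
    {A : H →ₗ[ℂ] H // IsGeneratingCentralUndirectedCayley A} :=
  Equiv.ofBijective
    (fun S => ⟨convolution (centralProjection S.1).val,
      (bijOn_convolution_centralProjection.mapsTo S.2.1).1,
      (bijOn_convolution_centralProjection.mapsTo S.2.1).2.1, centralProjection S.1, rfl, by
        rw [supp_centralProjection]; exact S.2.2⟩)
    ⟨fun _ _ h => Subtype.ext
        (convolution_centralProjection_injective (congrArg Subtype.val h)),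
      fun ⟨A, _, hA, P, hP, hg⟩ => by
        subst hP
        refine ⟨⟨P.supp, ?_, hg⟩, Subtype.ext (by simp only [centralProjection_supp])⟩
        rw [isSymmetric_iff, centralProjection_supp]
        exact antipode_eq_of_isUndirected hA⟩

end Bijections

end

theorem theorem3p4 (H : Type*) [CStarAlgebra H] [FiniteQuantumGroup H] :
    (∀ S : Set (Irr H), IsSymmetric S → IsGenerating S →
      IsCStarCorrespondence (edgeCorrespondence (convolution (centralProjection S).val)) ∧
      IsCStarCorrespondence (vergniouxCorrespondence (centralProjection S)) ∧
      ∃ Φ : EdgeSpace (convolution (centralProjection S).val) ≃ₗ[ℂ]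
          (vergniouxTriple (centralProjection S)).space,
        (∀ a b : H, (Φ (Submodule.Quotient.mk (a ⊗ₜ[ℂ] b)) : H ⊗[ℂ] H) =
          FiniteQuantumGroup.Δ H a * (1 ⊗ₜ[ℂ] b) * ((centralProjection S).val ⊗ₜ[ℂ] 1)) ∧
        IsCorrespondenceIso (edgeCorrespondence (convolution (centralProjection S).val))
          (vergniouxCorrespondence (centralProjection S)) Φ) ∧
    (∃ F : {Γ : GraphTriple H // IsVergniouxGraph Γ} ≃
        {A : H →ₗ[ℂ] H // IsGeneratingCentralUndirectedCayley A},
      ∀ (S : Set (Irr H)) (hS : IsSymmetric S) (hg : IsGenerating S),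
        (F ⟨vergniouxTriple (centralProjection S), S, hS, hg, rfl⟩).1 =
          convolution (centralProjection S).val) ∧
    Set.BijOn (fun S : Set (Irr H) => convolution (centralProjection S).val)
      {S | IsSymmetric S} {A | IsCentralUndirectedCayley A} := by
  -- Both equivalences start from the symmetric generating sets: the bijection reads S off the
  -- triple and then forms the convolution operator.
  refine ⟨fun S hS _ => ?_, ⟨(vergniouxEquiv H).symm.trans (cayleyEquiv H), fun S hS hg => ?_⟩,
    bijOn_convolution_centralProjection⟩
  · have hP := isSymmetric_iff.1 hS
    have hK := isCStarCorrespondence_vergniouxCorrespondence (centralProjection S)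
    have hΦ := isCorrespondenceIso_edgeEquiv hP
    exact ⟨hΦ.isCStarCorrespondence hK, hK, edgeEquiv hP,
      fun a b => coe_edgeMap_tmul (centralProjection S) a b, hΦ⟩
  · have h : (vergniouxEquiv H).symm ⟨vergniouxTriple (centralProjection S), S, hS, hg, rfl⟩ =
        ⟨S, hS, hg⟩ := (Equiv.symm_apply_eq _).2 rfl
    rw [Equiv.trans_apply, h]
    rfl
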